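/- Notation. Let $k,m,n,q,r\ge 0$ be integers with $k<n$, let $I=[0,1]$, and regard the cube $I^k$ as lying in the coordinate subspace $\mathbb R^k\subset\mathbb R^n$ of the first $k$ coordinates; $\partial I^k$ is its boundary in $\mathbb R^k$, and similarly $\partial I^m\subset I^m\subset\mathbb R^m$. A section of the jet space $J^r(\mathbb R^n,\mathbb R^q)$ over an open set $U\subset\mathbb R^n$ is identified with a map $x\mapsto (T_0(x),\dots,T_r(x))$ on $U$, where $T_j(x)$ is a symmetric $j$-linear map $(\mathbb R^n)^j\to\mathbb R^q$, and $\|\cdot\|$ is the maximum of the norms of the $T_j$. A section over an open set $U$ is holonomic if it equals $J^r_f=(f,Df,\dots,D^rf)$ on $U$ for some $C^r$ map $f:U\to\mathbb R^q$. Fix a class $C^s$, $s\in\{0,1,\dots,\infty\}$ ($s=0$: continuous, $s=\infty$: smooth). A family of sections $F_z$ is a map $(z,x)\mapsto F_z(x)$ that is jointly of class $C^s$. A family $F_z$, $z\in P$, is holonomic over a set $A\subset \mathbb R^n$ if on some open neighbourhood of $A$ there is a family of holonomic sections $G_z$, $z\in P$, with $G_z=F_z$ on $A$. "Near" a compact set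 means on some open neighbourhood of it, and neighbourhoods in $\mathbb R^n$ of $I^k$ and of $\partial I^k$ can be taken independent of $z$. Theorem. Let $F_z$, $z\in I^m$, be a family of sections of $J^r(\mathbb R^n,\mathbb R^q)$ over an open neighbourhood $U$ of $I^k$. Suppose that the family is holonomic over an open neighbourhood of $\partial I^k$ (for all $z\in I^m$), and that for $z\in I^m$ near $\partial I^m$ it is holonomic over $I^k$. Then for all $\delta,\varepsilon>0$ there exist a family of diffeomorphisms $h_z:\mathbb R^n\to\mathbb R^n$, $z\in I^m$, of the form $$h_z(x_1,\dots,x_n)=(x_1,\dots,x_{n-1},x_n+\varphi_z(x_1,\dots,x_k)),$$ with $\varphi_z(y)$ jointly smooth in $(z,y)\in I^m\times\mathbb R^k$, and a family of holonomic sections $\widetilde F_z$ of $J^r(\mathbb R^n,\mathbb R^q)$, $z\in I^m$, defined over open neighbourhoods $\Omega_z$ of $h_z(I^k)$ (the slices of an open set $\Omega\subset\mathbb R^m\times\mathbb R^n$), such that 1. $|\varphi_z|<\delta$ for all $z\in I^m$, and $\varphi_z=0$ near $\partial I^k$; 2. $\Omega_z\subset U$, so that $F_z$ is defined in a neighbourhood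 of $h_z(I^k)$, for all $z\in I^m$; 3. $\widetilde F_z=F_z$ near $\partial I^k$ for all $z\in I^m$; 4. for $z\in I^m$ near $\partial I^m$, $\widetilde F_z=F_z$ on $h_z(I^k)$; and if for $z\in I^m$ near $\partial I^m$ the family $F_z$ is even holonomic over an open neighbourhood of $I^k$, then $\widetilde F_z=F_z$ on all of $\Omega_z$ for $z\in I^m$ near $\partial I^m$; 5. $\|\widetilde F_z(x)-F_z(x)\|<\varepsilon$ for all $z\in I^m$ and $x\in\Omega_z$. -/

import Mathlib

open scoped ContDiff Manifold

/-- The fibre of `J^r(ℝⁿ, ℝ^q) → ℝⁿ`: an `r`-jet at a point is a tuple `(T₀, …, T_r)`, where `T_j`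
is a symmetric `j`-linear map `ℝⁿ × ⋯ × ℝⁿ → ℝ^q` standing for the `j`-th derivative. As
`J^r(ℝⁿ, ℝ^q)` is the product of `ℝⁿ` and this space, a section of `J^r(ℝⁿ, ℝ^q)` is a map from
`ℝⁿ` to this space. It carries the norm `max_j ‖T_j‖`. -/
def JetFiber (r n q : ℕ) : Submodule ℝ
    (∀ j : Fin (r + 1), EuclideanSpace ℝ (Fin n) [×(j : ℕ)]→L[ℝ] EuclideanSpace ℝ (Fin q)) where
  carrier := {T | ∀ (j : Fin (r + 1)) (σ : Equiv.Perm (Fin (j : ℕ)))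
    (v : Fin (j : ℕ) → EuclideanSpace ℝ (Fin n)), T j (v ∘ σ) = T j v}
  add_mem' := by
    intro a b ha hb j σ v
    change a j (v ∘ σ) + b j (v ∘ σ) = a j v + b j v
    rw [ha j σ v, hb j σ v]
  zero_mem' := by
    intro j σ v
    simp
  smul_mem' := by
    intro c a ha j σ v
    change c • a j (v ∘ σ) = c • a j v
    rw [ha j σ v]

/-- The tuple `(f(x), Df(x), …, D^r f(x))`: the `r`-jet `J^r_f(x)` of `f` at `x`. -/
noncomputable def jetOf (r : ℕ) {n q : ℕ}
    (f : EuclideanSpace ℝ (Fin n) → EuclideanSpace ℝ (Fin q)) (x : EuclideanSpace ℝ (Fin n)) :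
    ∀ j : Fin (r + 1), EuclideanSpace ℝ (Fin n) [×(j : ℕ)]→L[ℝ] EuclideanSpace ℝ (Fin q) :=
  fun j => iteratedFDeriv ℝ (j : ℕ) f x

/-- A section `G` over the open set `U` is holonomic: `G = J^r_f` on `U` for a map `f` of
class `C^r` on `U`. -/
def IsHolonomicOn {r n q : ℕ} (U : Set (EuclideanSpace ℝ (Fin n)))
    (G : EuclideanSpace ℝ (Fin n) → JetFiber r n q) : Prop :=
  ∃ f : EuclideanSpace ℝ (Fin n) → EuclideanSpace ℝ (Fin q), ContDiffOn ℝ r f U ∧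
    ∀ x ∈ U, (G x : ∀ j : Fin (r + 1),
      EuclideanSpace ℝ (Fin n) [×(j : ℕ)]→L[ℝ] EuclideanSpace ℝ (Fin q)) = jetOf r f x

/-- The section `F_z` is defined for `z ∈ P` on `{x | (z, x) ∈ Ω}`, and the family is of class `C^s`
jointly in `(z, x)`; for `s = 0` it is a continuous family of continuous sections, for `s = ∞` a
smooth family of smooth sections. -/
def IsSectionFamily (s : ℕ∞) {r m n q : ℕ} (P : Set (EuclideanSpace ℝ (Fin m)))
    (Ω : Set (EuclideanSpace ℝ (Fin m) × EuclideanSpace ℝ (Fin n)))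
    (F : EuclideanSpace ℝ (Fin m) → EuclideanSpace ℝ (Fin n) → JetFiber r n q) : Prop :=
  ContDiffOn ℝ s (Function.uncurry F) {p | p ∈ Ω ∧ p.1 ∈ P}

/-- The family `F_z`, `z ∈ P`, is holonomic over an arbitrary subset `A`: on some open neighbourhood
`U` of `A` there is a family (of class `C^s`) of holonomic sections `G_z`, `z ∈ P`, with
`G_z = F_z` on `A`. If `A` is open, this says that `F_z` itself is holonomic on `A`. -/
def IsHolonomicFamilyOver (s : ℕ∞) {r m n q : ℕ} (P : Set (EuclideanSpace ℝ (Fin m)))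
    (A : Set (EuclideanSpace ℝ (Fin n)))
    (F : EuclideanSpace ℝ (Fin m) → EuclideanSpace ℝ (Fin n) → JetFiber r n q) : Prop :=
  ∃ U : Set (EuclideanSpace ℝ (Fin n)), IsOpen U ∧ A ⊆ U ∧
    ∃ G : EuclideanSpace ℝ (Fin m) → EuclideanSpace ℝ (Fin n) → JetFiber r n q,
      IsSectionFamily s P (Set.univ ×ˢ U) G ∧
      ∀ z ∈ P, IsHolonomicOn U (G z) ∧ Set.EqOn (G z) (F z) A

/-- The unit cube `I^k = [0,1]^k` in the coordinate subspace `ℝ^k` of the first `k` coordinates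
of `ℝⁿ`. -/
def stdCube (k n : ℕ) : Set (EuclideanSpace ℝ (Fin n)) :=
  {x | ∀ i : Fin n, if (i : ℕ) < k then x i ∈ Set.Icc (0 : ℝ) 1 else x i = 0}

/-- The boundary `∂I^k` of the cube `I^k` inside `ℝ^k ⊆ ℝⁿ` (empty for `k = 0`). -/
def stdCubeBdry (k n : ℕ) : Set (EuclideanSpace ℝ (Fin n)) :=
  {x | x ∈ stdCube k n ∧ ∃ i : Fin n, (i : ℕ) < k ∧ (x i = 0 ∨ x i = 1)}

/-- The first `k` coordinates `(x₁, …, x_k)` of `x ∈ ℝⁿ`, for `k < n`. -/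
def firstCoords {k n : ℕ} (hkn : k < n) (x : EuclideanSpace ℝ (Fin n)) :
    EuclideanSpace ℝ (Fin k) :=
  WithLp.toLp 2 fun i => x (Fin.castLE hkn.le i)

/-- The map `(x₁, …, x_n) ↦ (x₁, …, x_{n-1}, x_n + φ(x₁, …, x_k))`. -/
noncomputable def verticalShear {k n : ℕ} (hkn : k < n) (φ : EuclideanSpace ℝ (Fin k) → ℝ)
    (x : EuclideanSpace ℝ (Fin n)) : EuclideanSpace ℝ (Fin n) :=
  WithLp.toLp 2 fun i => if (i : ℕ) + 1 = n then x i + φ (firstCoords hkn x) else x i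

open Set Filter Topology

/-! Fibrewise approximation is free: the Taylor polynomial `f_p` of `F_z(p)` at `p` (`jetPoly`) has
jets close to `F_z` near `p`. The defect is that it varies with `p`. This dependence is removed one
coordinate of the cube at a time (`FiberApprox.step`).

To remove `p_l`, take a grid of mesh `1/N` and blend, near `x`, the maps belonging to the even and
the odd grid values nearest to `x_l`, with a cutoff `θ` of the height of `x` over the present graph.
The even value jumps only where `N x_l` is odd, the odd value only where it is even. The new graph
oscillates around the old one: where `N x_l` is odd it lies so high that `θ = 1` and the even map is
not seen, where it is even so low that `θ = 0`. Hence the blend is of class `C^r` near the new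
graph. The order of choices is decisive: `θ` and the bounds on its derivatives are fixed with the
amplitude, before `N`. The two blended jets differ as little as desired for large `N`
(`FiberApprox.modulus`), so the blend stays close to `F` up to order `r`. The graph becomes steep,
but only its height has to be small; the height is available because `k < n`.

All estimates are uniform in `z` in a compact set, so one function `φ` serves all parameters. The
prescribed holonomic germs are glued to one family `b` (`exists_boundary_patch`), and the initial
maps (`blendedTaylor`) pass from the Taylor polynomial to `b`. This does not change the jet at `p`,
since `b` has jet `F_z(p)` there whenever its weight is nonzero. Where `b` has weight one for all
nearby `p`, every later blend combines `b` with itself. In that region the result is `b` at every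
height, so `φ` may be cut off to zero near both boundaries. -/

theorem eventually_eventuallyEq_slice {Z X E : Type*} [TopologicalSpace Z] [TopologicalSpace X]
    {S : Set Z} {f g : Z → X → E} {z : Z} {x : X}
    (h : ∀ᶠ w : Z × X in 𝓝[S ×ˢ univ] (z, x), f w.1 w.2 = g w.1 w.2) :
    ∀ᶠ w : Z × X in 𝓝[S ×ˢ univ] (z, x), f w.1 =ᶠ[𝓝 w.2] g w.1 := by
  rw [nhdsWithin_prod_eq, nhdsWithin_univ] at h ⊢
  obtain ⟨pa, ha, pb, hb, hab⟩ := Filter.eventually_prod_iff.1 h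
  refine Filter.eventually_prod_iff.2 ⟨pa, ha, _, eventually_eventually_nhds.2 hb, ?_⟩
  intro z' hz' x' hx'
  filter_upwards [hx'] with y hy using hab hz' hy

/-! ### Families whose derivatives in `x` depend on the parameter in a `C^s` way -/

section JetRegularity

variable {Z X E E₁ E₂ A : Type}
  [NormedAddCommGroup Z] [NormedSpace ℝ Z] [NormedAddCommGroup X] [NormedSpace ℝ X]
  [NormedAddCommGroup E] [NormedSpace ℝ E] [NormedAddCommGroup E₁] [NormedSpace ℝ E₁]
  [NormedAddCommGroup E₂] [NormedSpace ℝ E₂] [NormedAddCommGroup A] [NormedSpace ℝ A]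

/-- The family `f z`, `z ∈ S`, consists of maps of class `C^r` near `(z, x)` whose derivatives up to
order `r` are jointly of class `C^s` at `(z, x)`. -/
def JetRegAt (s : ℕ∞) (r : ℕ) (S : Set Z) (f : Z → X → E) (z : Z) (x : X) : Prop :=
  (∀ᶠ w : Z × X in 𝓝[S ×ˢ univ] (z, x), ContDiffAt ℝ r (f w.1) w.2) ∧
    ∀ j ≤ r, ContDiffWithinAt ℝ s (fun w : Z × X => iteratedFDeriv ℝ j (f w.1) w.2)
      (S ×ˢ univ) (z, x)

variable {s : ℕ∞} {r : ℕ} {S : Set Z} {f g : Z → X → E} {z : Z} {x : X}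

theorem JetRegAt.contDiffAt (hf : JetRegAt s r S f z x) (hz : z ∈ S) : ContDiffAt ℝ r (f z) x :=
  hf.1.self_of_nhdsWithin (x := (z, x)) ⟨hz, mem_univ x⟩

theorem JetRegAt.congr (hf : JetRegAt s r S f z x) (hz : z ∈ S)
    (h : ∀ᶠ w : Z × X in 𝓝[S ×ˢ univ] (z, x), f w.1 w.2 = g w.1 w.2) : JetRegAt s r S g z x := by
  have h' := eventually_eventuallyEq_slice h
  refine ⟨?_, fun j hj => ?_⟩
  · filter_upwards [hf.1, h'] with w hw hw' using hw.congr_of_eventuallyEq hw'.symm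
  · have h2 : (fun w : Z × X => iteratedFDeriv ℝ j (g w.1) w.2) =ᶠ[𝓝[S ×ˢ univ] (z, x)]
        fun w : Z × X => iteratedFDeriv ℝ j (f w.1) w.2 := by
      filter_upwards [h'] with w hw using (hw.symm.iteratedFDeriv ℝ j).self_of_nhds
    exact (hf.2 j hj).congr_of_eventuallyEq h2 (h2.self_of_nhdsWithin ⟨hz, mem_univ x⟩)

theorem JetRegAt.mono_set {T : Set Z} (hf : JetRegAt s r T f z x) (h : T ∈ 𝓝[S] z) :
    JetRegAt s r S f z x := by
  have hT : T ×ˢ (univ : Set X) ∈ 𝓝[S ×ˢ univ] (z, x) := by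
    rw [nhdsWithin_prod_eq, nhdsWithin_univ]
    exact prod_mem_prod h univ_mem
  exact ⟨hf.1.filter_mono (nhdsWithin_le_of_mem hT),
    fun j hj => (hf.2 j hj).mono_of_mem_nhdsWithin hT⟩

theorem JetRegAt.of_le {s' : ℕ∞} (hf : JetRegAt s r S f z x) (hs : s' ≤ s) :
    JetRegAt s' r S f z x :=
  ⟨hf.1, fun j hj => (hf.2 j hj).of_le (by exact_mod_cast hs)⟩

theorem JetRegAt.comp_param {S' : Set A} {a : A → Z} {w : A}
    (hf : JetRegAt s r S f (a w) x) (ha : ContDiffWithinAt ℝ s a S' w) (hm : MapsTo a S' S) :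
    JetRegAt s r S' (fun w => f (a w)) w x := by
  have hmaps : MapsTo (fun v : A × X => (a v.1, v.2)) (S' ×ˢ univ) (S ×ˢ univ) :=
    fun v hv => ⟨hm hv.1, hv.2⟩
  have h1 : ContDiffWithinAt ℝ s (fun v : A × X => (a v.1, v.2)) (S' ×ˢ univ) (w, x) :=
    (ha.comp (w, x) contDiffWithinAt_fst fun v hv => hv.1).prodMk contDiffWithinAt_snd
  refine ⟨(h1.continuousWithinAt.tendsto_nhdsWithin hmaps).eventually hf.1, fun j hj => ?_⟩
  exact (hf.2 j hj).comp (w, x) h1 hmaps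

theorem JetRegAt.add (hf : JetRegAt s r S f z x) (hg : JetRegAt s r S g z x) (hz : z ∈ S) :
    JetRegAt s r S (fun z x => f z x + g z x) z x := by
  refine ⟨?_, fun j hj => ?_⟩
  · filter_upwards [hf.1, hg.1] with w h1 h2 using h1.add h2
  · have h2 : (fun w : Z × X => iteratedFDeriv ℝ j (fun y => f w.1 y + g w.1 y) w.2)
        =ᶠ[𝓝[S ×ˢ univ] (z, x)]
        fun w => iteratedFDeriv ℝ j (f w.1) w.2 + iteratedFDeriv ℝ j (g w.1) w.2 := by
      filter_upwards [hf.1, hg.1] with w h1 h2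
      exact iteratedFDeriv_add_apply (h1.of_le (by exact_mod_cast hj))
        (h2.of_le (by exact_mod_cast hj))
    exact ((hf.2 j hj).add (hg.2 j hj)).congr_of_eventuallyEq h2
      (h2.self_of_nhdsWithin ⟨hz, mem_univ x⟩)

theorem JetRegAt.sub (hf : JetRegAt s r S f z x) (hg : JetRegAt s r S g z x) (hz : z ∈ S) :
    JetRegAt s r S (fun z x => f z x - g z x) z x := by
  refine ⟨?_, fun j hj => ?_⟩
  · filter_upwards [hf.1, hg.1] with w h1 h2 using h1.sub h2
  · have h2 : (fun w : Z × X => iteratedFDeriv ℝ j (fun y => f w.1 y - g w.1 y) w.2)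
        =ᶠ[𝓝[S ×ˢ univ] (z, x)]
        fun w => iteratedFDeriv ℝ j (f w.1) w.2 - iteratedFDeriv ℝ j (g w.1) w.2 := by
      filter_upwards [hf.1, hg.1] with w h1 h2
      exact iteratedFDeriv_sub_apply (h1.of_le (by exact_mod_cast hj))
        (h2.of_le (by exact_mod_cast hj))
    exact ((hf.2 j hj).sub (hg.2 j hj)).congr_of_eventuallyEq h2
      (h2.self_of_nhdsWithin ⟨hz, mem_univ x⟩)

theorem contDiffWithinAt_iteratedFDeriv_zero_iff {T : Set (Z × X)} {w₀ : Z × X} :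
    ContDiffWithinAt ℝ s (fun w : Z × X => iteratedFDeriv ℝ 0 (f w.1) w.2) T w₀ ↔
      ContDiffWithinAt ℝ s (fun w : Z × X => f w.1 w.2) T w₀ := by
  have : (fun w : Z × X => iteratedFDeriv ℝ 0 (f w.1) w.2) =
      (continuousMultilinearCurryFin0 ℝ X E).symm ∘ fun w : Z × X => f w.1 w.2 := by
    funext w
    rw [iteratedFDeriv_zero_eq_comp]; rfl
  rw [this]
  exact (continuousMultilinearCurryFin0 ℝ X E).symm.toContinuousLinearEquiv.comp_contDiffWithinAt_iff

theorem contDiffWithinAt_iteratedFDeriv_succ_iff {T : Set (Z × X)} {w₀ : Z × X} {j : ℕ} :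
    ContDiffWithinAt ℝ s (fun w : Z × X => iteratedFDeriv ℝ (j + 1) (f w.1) w.2) T w₀ ↔
      ContDiffWithinAt ℝ s (fun w : Z × X => iteratedFDeriv ℝ j (fderiv ℝ (f w.1)) w.2) T w₀ := by
  have : (fun w : Z × X => iteratedFDeriv ℝ (j + 1) (f w.1) w.2) =
      (continuousMultilinearCurryRightEquiv' ℝ j X E).symm ∘
        fun w : Z × X => iteratedFDeriv ℝ j (fderiv ℝ (f w.1)) w.2 := by
    funext w
    rw [iteratedFDeriv_succ_eq_comp_right]; rfl
  rw [this]
  refine ⟨fun h => ?_, fun h =>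
    (continuousMultilinearCurryRightEquiv' ℝ j X E).symm.contDiff.comp_contDiffWithinAt h⟩
  have hc : ContDiff ℝ s (continuousMultilinearCurryRightEquiv' ℝ j X E) :=
    LinearIsometryEquiv.contDiff (F := X [×j]→L[ℝ] X →L[ℝ] E) (E := X [×(j + 1)]→L[ℝ] E) _
  have h' := hc.comp_contDiffWithinAt h
  simpa [Function.comp_def] using h'

theorem JetRegAt.contDiffWithinAt (hf : JetRegAt s r S f z x) :
    ContDiffWithinAt ℝ s (fun w : Z × X => f w.1 w.2) (S ×ˢ univ) (z, x) :=
  contDiffWithinAt_iteratedFDeriv_zero_iff.1 (hf.2 0 (Nat.zero_le _))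

theorem jetRegAt_zero_iff : JetRegAt s 0 S f z x ↔
    (∀ᶠ w : Z × X in 𝓝[S ×ˢ univ] (z, x), ContDiffAt ℝ 0 (f w.1) w.2) ∧
      ContDiffWithinAt ℝ s (fun w : Z × X => f w.1 w.2) (S ×ˢ univ) (z, x) := by
  refine ⟨fun h => ⟨by simpa using h.1, h.contDiffWithinAt⟩, fun h => ⟨by simpa using h.1, ?_⟩⟩
  intro j hj
  obtain rfl : j = 0 := by omega
  exact contDiffWithinAt_iteratedFDeriv_zero_iff.2 h.2

theorem jetRegAt_succ_iff : JetRegAt s (r + 1) S f z x ↔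
    (∀ᶠ w : Z × X in 𝓝[S ×ˢ univ] (z, x), ContDiffAt ℝ (r + 1 : ℕ) (f w.1) w.2) ∧
      ContDiffWithinAt ℝ s (fun w : Z × X => f w.1 w.2) (S ×ˢ univ) (z, x) ∧
      JetRegAt s r S (fun z => fderiv ℝ (f z)) z x := by
  refine ⟨fun h => ⟨h.1, h.contDiffWithinAt, ?_, fun j hj => ?_⟩, fun h => ⟨h.1, fun j hj => ?_⟩⟩
  · filter_upwards [h.1] with w hw using hw.fderiv_right (by norm_cast)
  · exact contDiffWithinAt_iteratedFDeriv_succ_iff.1 (h.2 (j + 1) (by omega))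
  · cases j with
    | zero => exact contDiffWithinAt_iteratedFDeriv_zero_iff.2 h.2.1
    | succ j => exact contDiffWithinAt_iteratedFDeriv_succ_iff.2 (h.2.2.2 j (by omega))

theorem JetRegAt.of_succ (h : JetRegAt s (r + 1) S f z x) : JetRegAt s r S f z x :=
  ⟨h.1.mono fun _ hw => hw.of_le (by norm_cast; omega), fun j hj => h.2 j (by omega)⟩

/-- Induction on `r` by the product rule: the derivative is the sum of the pairings of `u` with `v'`
and of `u'` with `v`, again bilinear but with other spaces, so the spaces must vary in the
induction. -/
theorem JetRegAt.bilinear (B : E₁ →L[ℝ] E₂ →L[ℝ] E) {u : Z → X → E₁} {v : Z → X → E₂}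
    (hu : JetRegAt s r S u z x) (hv : JetRegAt s r S v z x) (hz : z ∈ S) :
    JetRegAt s r S (fun z x => B (u z x) (v z x)) z x := by
  have hC : ContDiffWithinAt ℝ s (fun w : Z × X => B (u w.1 w.2) (v w.1 w.2))
      (S ×ˢ univ) (z, x) :=
    (B.contDiff.comp_contDiffWithinAt hu.contDiffWithinAt).clm_apply hv.contDiffWithinAt
  have hD : ∀ᶠ w : Z × X in 𝓝[S ×ˢ univ] (z, x),
      ContDiffAt ℝ r (fun y => B (u w.1 y) (v w.1 y)) w.2 := by
    filter_upwards [hu.1, hv.1] with w h1 h2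
    exact (B.contDiff.contDiffAt.comp w.2 h1).clm_apply h2
  induction r generalizing E E₁ E₂ with
  | zero => exact jetRegAt_zero_iff.2 ⟨by simpa using hD, hC⟩
  | succ r ih =>
    refine jetRegAt_succ_iff.2 ⟨hD, hC, ?_⟩
    have hu' := (jetRegAt_succ_iff.1 hu).2.2
    have hv' := (jetRegAt_succ_iff.1 hv).2.2
    have aux : ∀ {F₁ F₂ F : Type} [NormedAddCommGroup F₁] [NormedSpace ℝ F₁]
        [NormedAddCommGroup F₂] [NormedSpace ℝ F₂] [NormedAddCommGroup F] [NormedSpace ℝ F]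
        (B' : F₁ →L[ℝ] F₂ →L[ℝ] F) {u : Z → X → F₁} {v : Z → X → F₂},
        JetRegAt s r S u z x → JetRegAt s r S v z x →
        JetRegAt s r S (fun z x => B' (u z x) (v z x)) z x := by
      intro F₁ F₂ F _ _ _ _ _ _ B' u v hu hv
      refine ih B' hu hv ?_ ?_
      · exact (B'.contDiff.comp_contDiffWithinAt hu.contDiffWithinAt).clm_apply
          hv.contDiffWithinAt
      · filter_upwards [hu.1, hv.1] with w h1 h2
        exact (B'.contDiff.contDiffAt.comp w.2 h1).clm_apply h2
    refine ((aux (B.precompR X) hu.of_succ hv').add (aux (B.precompL X) hu' hv.of_succ) hz).congr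
      hz ?_
    filter_upwards [hu.1, hv.1] with w h1 h2
    exact (B.fderiv_of_bilinear (h1.differentiableAt (by simp))
      (h2.differentiableAt (by simp))).symm

theorem JetRegAt.smul {u : Z → X → ℝ} (hu : JetRegAt s r S u z x) (hf : JetRegAt s r S f z x)
    (hz : z ∈ S) : JetRegAt s r S (fun z x => u z x • f z x) z x :=
  JetRegAt.bilinear (ContinuousLinearMap.lsmul ℝ ℝ) hu hf hz

theorem ContDiff.iteratedFDeriv_uncurry {Ψ : A → X → E} (hΨ : ContDiff ℝ ∞ (Function.uncurry Ψ))
    (j : ℕ) : ContDiff ℝ ∞ fun w : A × X => iteratedFDeriv ℝ j (Ψ w.1) w.2 := by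
  induction j generalizing E with
  | zero =>
    have : (fun w : A × X => iteratedFDeriv ℝ 0 (Ψ w.1) w.2) =
        (continuousMultilinearCurryFin0 ℝ X E).symm ∘ fun w : A × X => Ψ w.1 w.2 := by
      funext w
      rw [iteratedFDeriv_zero_eq_comp]; rfl
    rw [this]
    exact (continuousMultilinearCurryFin0 ℝ X E).symm.contDiff.comp hΨ
  | succ j ih =>
    have : (fun w : A × X => iteratedFDeriv ℝ (j + 1) (Ψ w.1) w.2) =
        (continuousMultilinearCurryRightEquiv' ℝ j X E).symm ∘
          fun w : A × X => iteratedFDeriv ℝ j (fderiv ℝ (Ψ w.1)) w.2 := by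
      funext w
      rw [iteratedFDeriv_succ_eq_comp_right]; rfl
    rw [this]
    refine (continuousMultilinearCurryRightEquiv' ℝ j X E).symm.contDiff.comp
      (ih (Ψ := fun a => fderiv ℝ (Ψ a)) ?_)
    have h3 : ContDiff ℝ ∞ (Function.uncurry fun (w : A × X) (y : X) => Ψ w.1 y) :=
      hΨ.comp ((contDiff_fst.comp contDiff_fst).prodMk contDiff_snd)
    exact ContDiff.fderiv h3 contDiff_snd (by norm_cast)

/-- The parameter is only of class `C^s`, but it enters through a smooth universal family `Ψ`, whose
derivatives in `x` are smooth in all variables. -/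
theorem jetRegAt_of_contDiff {Ψ : A → X → E} (hΨ : ContDiff ℝ ∞ (Function.uncurry Ψ)) {a : Z → A}
    (ha : ContDiffWithinAt ℝ s a S z) : JetRegAt s r S (fun z => Ψ (a z)) z x := by
  refine ⟨Eventually.of_forall fun w => ?_, fun j _ => ?_⟩
  · have : ContDiff ℝ ∞ (Ψ (a w.1)) := hΨ.comp (contDiff_const.prodMk contDiff_id)
    exact this.contDiffAt.of_le (by exact_mod_cast le_top)
  · have h1 : ContDiff ℝ s fun w : A × X => iteratedFDeriv ℝ j (Ψ w.1) w.2 :=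
      (ContDiff.iteratedFDeriv_uncurry hΨ j).of_le (by exact_mod_cast le_top)
    have h2 : ContDiffWithinAt ℝ s (fun w : Z × X => (a w.1, w.2)) (S ×ˢ univ) (z, x) :=
      (ha.comp (z, x) contDiffWithinAt_fst fun w hw => hw.1).prodMk contDiffWithinAt_snd
    exact h1.comp_contDiffWithinAt h2

theorem jetRegAt_of_contDiff_const {h : X → E} (hh : ContDiff ℝ ∞ h) :
    JetRegAt s r S (fun _ => h) z x :=
  jetRegAt_of_contDiff (Ψ := fun (_ : ℝ) => h) (a := fun _ => 0) (hh.comp contDiff_snd)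
    contDiffWithinAt_const

theorem jetRegAt_of_contDiffWithinAt {a : Z → ℝ} (ha : ContDiffWithinAt ℝ s a S z) :
    JetRegAt s r S (fun z (_ : X) => a z) z x :=
  jetRegAt_of_contDiff (Ψ := fun (c : ℝ) (_ : X) => c) contDiff_fst ha

end JetRegularity

/-! ### Symmetry of higher derivatives -/

section IteratedDerivativeSymmetry

theorem natCast_ne_infty (n : ℕ) : ((n : ℕ) : WithTop ℕ∞) ≠ ∞ := by simp

variable {X E : Type} [NormedAddCommGroup X] [NormedSpace ℝ X] [NormedAddCommGroup E]
  [NormedSpace ℝ E]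

/-- A swap that fixes the first slot is a symmetry of the derivative of order `n + 1` near `x`,
which survives one more differentiation. The swap of the first two slots fixes the last one when `n
> 0`, and becomes a symmetry of the derivative of order `n + 1` of `fderiv ℝ f`; this is why `ih`
must allow any target. For `n = 0` it is the symmetry of the second derivative. -/
theorem ContDiffAt.iteratedFDeriv_adjacent_swap {n : ℕ}
    (ih : ∀ {E : Type} [NormedAddCommGroup E] [NormedSpace ℝ E] {f : X → E} {x : X},
      ContDiffAt ℝ (n + 1 : ℕ) f x → ∀ (v : Fin (n + 1) → X) (σ : Equiv.Perm (Fin (n + 1))),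
        iteratedFDeriv ℝ (n + 1) f x (v ∘ σ) = iteratedFDeriv ℝ (n + 1) f x v)
    {f : X → E} {x : X} (hf : ContDiffAt ℝ (n + 2 : ℕ) f x) (v : Fin (n + 2) → X)
    (i : Fin (n + 1)) :
    iteratedFDeriv ℝ (n + 2) f x (v ∘ Equiv.swap i.castSucc i.succ) =
      iteratedFDeriv ℝ (n + 2) f x v := by
  induction i using Fin.cases with
  | succ j =>
    have h0 : (v ∘ Equiv.swap j.succ.castSucc j.succ.succ) 0 = v 0 := by
      simp only [Function.comp_apply]
      rw [Equiv.swap_apply_of_ne_of_ne]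
      · simp [Fin.ext_iff]
      · simp [Fin.ext_iff]
    have ht : Fin.tail (v ∘ Equiv.swap j.succ.castSucc j.succ.succ) =
        Fin.tail v ∘ Equiv.swap j.castSucc j.succ := by
      funext a
      simp only [Fin.tail, Function.comp_apply]
      rw [(Fin.succ_injective _).map_swap]
      rfl
    rw [iteratedFDeriv_succ_apply_left, iteratedFDeriv_succ_apply_left, h0, ht]
    have hd : DifferentiableAt ℝ (iteratedFDeriv ℝ (n + 1) f) x :=
      (hf.iteratedFDeriv_right (m := 1) (i := n + 1)
        (by norm_cast; omega)).differentiableAt (by simp)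
    have key : ∀ w, fderiv ℝ (iteratedFDeriv ℝ (n + 1) f) x (v 0) w =
        fderiv ℝ (fun y => iteratedFDeriv ℝ (n + 1) f y w) x (v 0) := fun w =>
      (fderiv_continuousMultilinear_apply_const_apply hd w (v 0)).symm
    rw [key, key]
    have hev : (fun y => iteratedFDeriv ℝ (n + 1) f y
        (Fin.tail v ∘ Equiv.swap j.castSucc j.succ)) =ᶠ[𝓝 x]
        fun y => iteratedFDeriv ℝ (n + 1) f y (Fin.tail v) := by
      filter_upwards [hf.eventually (natCast_ne_infty _)] with y hy
      exact ih (hy.of_le (by norm_cast; omega)) _ _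
    rw [hev.fderiv_eq]
  | zero =>
    cases n with
    | zero =>
      have hs : IsSymmSndFDerivAt ℝ f x := hf.isSymmSndFDerivAt (by simp)
      have := (isSymmSndFDerivAt_iff_iteratedFDeriv (f := f) (x := x)).1 hs
      have h2 := congrArg (fun T => T v) this
      simp only [ContinuousMultilinearMap.domDomCongr_apply] at h2
      rw [← h2]
      congr 1
      funext a
      fin_cases a <;> rfl
    | succ n =>
      have hl : (v ∘ Equiv.swap (0 : Fin (n + 2)).castSucc (0 : Fin (n + 2)).succ)
          (Fin.last (n + 2)) = v (Fin.last (n + 2)) := by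
        simp only [Function.comp_apply]
        rw [Equiv.swap_apply_of_ne_of_ne]
        · simp [Fin.ext_iff]
        · simp [Fin.ext_iff]
      have hi : Fin.init (v ∘ Equiv.swap (0 : Fin (n + 2)).castSucc (0 : Fin (n + 2)).succ) =
          Fin.init v ∘ Equiv.swap (0 : Fin (n + 1)).castSucc (0 : Fin (n + 1)).succ := by
        funext a
        simp only [Fin.init, Function.comp_apply]
        rw [(Fin.castSucc_injective _).map_swap]
        rfl
      rw [iteratedFDeriv_succ_apply_right (v ∘ _), iteratedFDeriv_succ_apply_right v, hl, hi]
      rw [ih (hf.fderiv_right (by norm_cast))]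

/-- The iterated derivatives of a map of class `C^n` are symmetric up to order `n`. -/
theorem ContDiffAt.iteratedFDeriv_comp_perm_of_nat {n : ℕ} {f : X → E} {x : X}
    (hf : ContDiffAt ℝ n f x) (v : Fin n → X) (σ : Equiv.Perm (Fin n)) :
    iteratedFDeriv ℝ n f x (v ∘ σ) = iteratedFDeriv ℝ n f x v := by
  induction n generalizing E x with
  | zero => rw [Subsingleton.elim (v ∘ σ) v]
  | succ n ih =>
    cases n with
    | zero =>
      obtain rfl : σ = 1 := Equiv.ext fun a => Subsingleton.elim (α := Fin 1) _ _
      rfl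
    | succ n =>
      -- Adjacent transpositions generate the symmetric group.
      have hmem : σ ∈ Submonoid.closure
          (Set.range fun i : Fin (n + 1) => Equiv.swap i.castSucc i.succ) := by
        rw [Equiv.Perm.mclosure_swap_castSucc_succ]; trivial
      induction hmem using Submonoid.closure_induction generalizing v with
      | mem τ hτ =>
        obtain ⟨i, rfl⟩ := hτ
        exact ContDiffAt.iteratedFDeriv_adjacent_swap (fun h v σ => ih h v σ) hf v i
      | one => rfl
      | mul a b _ _ ha hb =>
        have : v ∘ (a * b : Equiv.Perm (Fin (n + 2))) = (v ∘ a) ∘ b := rfl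
        rw [this, hb, ha]

end IteratedDerivativeSymmetry

/-! ### Jets: Leibniz estimates and Taylor polynomials -/

section Jets

theorem contDiff_multilinear_diag {j : ℕ} {X E : Type} [NormedAddCommGroup X]
    [NormedSpace ℝ X] [NormedAddCommGroup E] [NormedSpace ℝ E] :
    ContDiff ℝ ∞ fun w : (X [×j]→L[ℝ] E) × X => w.1 fun _ => w.2 := by
  have h1 : ContDiff ℝ ∞ fun p : (X [×j]→L[ℝ] E) × (Fin j → X) => p.1 p.2 :=
    AnalyticOnNhd.contDiff
      (ContinuousLinearMap.id ℝ (X [×j]→L[ℝ] E)).analyticOnNhd_uncurry_of_multilinear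
  have h2 : ContDiff ℝ ∞ fun w : (X [×j]→L[ℝ] E) × X => (w.1, fun _ : Fin j => w.2) :=
    contDiff_fst.prodMk (contDiff_pi.2 fun _ => contDiff_snd)
  exact h1.comp h2

theorem contDiff_fst_apply {ι : Type} [Fintype ι] {F : ι → Type}
    [∀ i, NormedAddCommGroup (F i)] [∀ i, NormedSpace ℝ (F i)] {X : Type} [NormedAddCommGroup X] [NormedSpace ℝ X]
    (i : ι) : ContDiff ℝ ∞ fun w : (∀ i, F i) × X => w.1 i := contDiff_pi.1 contDiff_fst i

variable {r n q : ℕ} {f g : EuclideanSpace ℝ (Fin n) → EuclideanSpace ℝ (Fin q)}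
  {x : EuclideanSpace ℝ (Fin n)}

theorem jetOf_mem_jetFiber (hf : ContDiffAt ℝ r f x) : jetOf r f x ∈ JetFiber r n q :=
  fun j σ v => (hf.of_le (by exact_mod_cast Nat.le_of_lt_succ j.2)).iteratedFDeriv_comp_perm_of_nat
    v σ

theorem ContDiffAt.of_fin (hf : ContDiffAt ℝ r f x) (j : Fin (r + 1)) :
    ContDiffAt ℝ (j : ℕ) f x :=
  hf.of_le (by exact_mod_cast Nat.le_of_lt_succ j.2)

theorem jetOf_add (hf : ContDiffAt ℝ r f x) (hg : ContDiffAt ℝ r g x) :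
    jetOf r (fun y => f y + g y) x = jetOf r f x + jetOf r g x :=
  funext fun j => iteratedFDeriv_add_apply (hf.of_fin j) (hg.of_fin j)

theorem jetOf_sub (hf : ContDiffAt ℝ r f x) (hg : ContDiffAt ℝ r g x) :
    jetOf r (fun y => f y - g y) x = jetOf r f x - jetOf r g x :=
  funext fun j => iteratedFDeriv_sub_apply (hf.of_fin j) (hg.of_fin j)

theorem jetOf_congr (h : f =ᶠ[𝓝 x] g) : jetOf r f x = jetOf r g x :=
  funext fun j => (h.iteratedFDeriv ℝ (j : ℕ)).self_of_nhds

theorem norm_iteratedFDeriv_smul_le_of_contDiffAt {θ : EuclideanSpace ℝ (Fin n) → ℝ}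
    (hθ : ContDiff ℝ ∞ θ) {j : ℕ} (hf : ContDiffAt ℝ j f x) :
    ‖iteratedFDeriv ℝ j (fun y => θ y • f y) x‖ ≤ ∑ i ∈ Finset.range (j + 1),
      (j.choose i : ℝ) * ‖iteratedFDeriv ℝ i θ x‖ * ‖iteratedFDeriv ℝ (j - i) f x‖ := by
  obtain ⟨u, hu, hxu, hfu⟩ : ∃ u, IsOpen u ∧ x ∈ u ∧ ContDiffOn ℝ j f u := by
    obtain ⟨u, hu, hxu⟩ := eventually_nhds_iff.1 (hf.eventually (natCast_ne_infty _))
    exact ⟨u, hxu.1, hxu.2, fun y hy => (hu y hy).contDiffWithinAt⟩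
  have := norm_iteratedFDerivWithin_smul_le (𝕜 := ℝ) (n := j)
    ((hθ.of_le (by exact_mod_cast le_top)).contDiffOn (s := u)) hfu hu.uniqueDiffOn hxu le_rfl
  simpa only [iteratedFDerivWithin_of_isOpen _ hu hxu] using this

/-- Leibniz formula with the derivatives of `θ` bounded on `K`. That `C` does not depend on `f` is
essential: the grid is refined after `θ` has been fixed. -/
theorem norm_jetOf_smul_le (r q : ℕ) {θ : EuclideanSpace ℝ (Fin n) → ℝ} (hθ : ContDiff ℝ ∞ θ)
    {K : Set (EuclideanSpace ℝ (Fin n))} (hK : IsCompact K) :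
    ∃ C, 0 < C ∧ ∀ x ∈ K, ∀ f : EuclideanSpace ℝ (Fin n) → EuclideanSpace ℝ (Fin q),
      ContDiffAt ℝ r f x → ‖jetOf r (fun y => θ y • f y) x‖ ≤ C * ‖jetOf r f x‖ := by
  have hM : ∀ i : ℕ, ∃ M, 0 ≤ M ∧ ∀ x ∈ K, ‖iteratedFDeriv ℝ i θ x‖ ≤ M := by
    intro i
    have hc : Continuous (iteratedFDeriv ℝ i θ) :=
      hθ.continuous_iteratedFDeriv (by exact_mod_cast le_top)
    obtain ⟨M, hM⟩ := hK.exists_bound_of_continuousOn hc.continuousOn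
    exact ⟨max M 0, le_max_right _ _, fun x hx => (hM x hx).trans (le_max_left _ _)⟩
  choose M hM0 hM using hM
  have hnn : ∀ j, 0 ≤ ∑ i ∈ Finset.range (j + 1), (j.choose i : ℝ) * M i := fun j =>
    Finset.sum_nonneg fun i _ => mul_nonneg (by positivity) (hM0 i)
  refine ⟨1 + ∑ j ∈ Finset.range (r + 1), ∑ i ∈ Finset.range (j + 1), (j.choose i : ℝ) * M i,
    by linarith [Finset.sum_nonneg fun j (_ : j ∈ Finset.range (r + 1)) => hnn j], ?_⟩
  intro x hx f hf
  rw [pi_norm_le_iff_of_nonneg (mul_nonneg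
    (by linarith [Finset.sum_nonneg fun j (_ : j ∈ Finset.range (r + 1)) => hnn j])
    (norm_nonneg _))]
  intro j
  refine (norm_iteratedFDeriv_smul_le_of_contDiffAt hθ (hf.of_fin j)).trans ?_
  have h1 : ∀ i ∈ Finset.range ((j : ℕ) + 1), ((j : ℕ).choose i : ℝ) * ‖iteratedFDeriv ℝ i θ x‖ *
      ‖iteratedFDeriv ℝ (j - i) f x‖ ≤ ((j : ℕ).choose i : ℝ) * M i * ‖jetOf r f x‖ := by
    intro i _
    have h2 : ‖iteratedFDeriv ℝ (j - i) f x‖ ≤ ‖jetOf r f x‖ :=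
      norm_le_pi_norm (jetOf r f x) ⟨j - i, by omega⟩
    have h3 := hM i x hx
    have := hM0 i
    gcongr
  refine (Finset.sum_le_sum h1).trans ?_
  rw [← Finset.sum_mul]
  gcongr
  have := Finset.single_le_sum (f := fun j => ∑ i ∈ Finset.range (j + 1), (j.choose i : ℝ) * M i)
    (fun j _ => hnn j) (Finset.mem_range.2 j.2)
  linarith

theorem jetOf_smul_eq_zero {θ : EuclideanSpace ℝ (Fin n) → ℝ} (hθ : ContDiff ℝ ∞ θ)
    (hf : ContDiffAt ℝ r f x) (h : jetOf r f x = 0) : jetOf r (fun y => θ y • f y) x = 0 := by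
  obtain ⟨C, -, hC⟩ := norm_jetOf_smul_le r q hθ (isCompact_singleton (x := x))
  have := hC x rfl f hf
  rw [h, norm_zero, mul_zero] at this
  exact norm_le_zero_iff.1 this

/-- The polynomial map with the prescribed derivatives at the origin. -/
noncomputable def jetPoly
    (T : ∀ j : Fin (r + 1), EuclideanSpace ℝ (Fin n) [×(j : ℕ)]→L[ℝ] EuclideanSpace ℝ (Fin q))
    (v : EuclideanSpace ℝ (Fin n)) : EuclideanSpace ℝ (Fin q) :=
  ∑ j : Fin (r + 1), (((j : ℕ).factorial : ℝ)⁻¹) • T j fun _ => v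

theorem contDiff_uncurry_jetPoly :
    ContDiff ℝ ∞ (Function.uncurry (jetPoly (r := r) (n := n) (q := q))) := by
  have h : ∀ j : Fin (r + 1), ContDiff ℝ ∞ fun w : (∀ j : Fin (r + 1),
      EuclideanSpace ℝ (Fin n) [×(j : ℕ)]→L[ℝ] EuclideanSpace ℝ (Fin q)) ×
      EuclideanSpace ℝ (Fin n) => w.1 j fun _ => w.2 := fun j => by
    have h1 := contDiff_fst_apply (F := fun j : Fin (r + 1) =>
      EuclideanSpace ℝ (Fin n) [×(j : ℕ)]→L[ℝ] EuclideanSpace ℝ (Fin q))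
      (X := EuclideanSpace ℝ (Fin n)) j
    exact contDiff_multilinear_diag.comp (h1.prodMk contDiff_snd)
  have h2 : ∀ j : Fin (r + 1), ContDiff ℝ ∞ fun w : (∀ j : Fin (r + 1),
      EuclideanSpace ℝ (Fin n) [×(j : ℕ)]→L[ℝ] EuclideanSpace ℝ (Fin q)) ×
      EuclideanSpace ℝ (Fin n) => (((j : ℕ).factorial : ℝ)⁻¹) • w.1 j fun _ => w.2 :=
    fun j => (h j).const_smul _
  exact ContDiff.sum (s := Finset.univ) fun j _ => h2 j


/-- The `j`-th derivative of a power series at its centre is the sum of its `j`-th term over all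
permutations of the arguments. As `T_j` is symmetric, these are `j!` equal summands, which cancels
the factor `1/j!`. -/
theorem jetOf_jetPoly_zero (T : JetFiber r n q) : jetOf r (jetPoly T.1) 0 = T.1 := by
  let p : FormalMultilinearSeries ℝ (EuclideanSpace ℝ (Fin n)) (EuclideanSpace ℝ (Fin q)) :=
    fun j => if h : j < r + 1 then ((j.factorial : ℝ)⁻¹) • T.1 ⟨j, h⟩ else 0
  have hp : HasFiniteFPowerSeriesOnBall (jetPoly T.1) p 0 (r + 1) ⊤ := by
    refine HasFiniteFPowerSeriesOnBall.mk' (fun m hm => ?_) (by simp) fun y _ => ?_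
    · simp only [p]
      rw [dif_neg (by omega)]
    · rw [zero_add, jetPoly, Finset.sum_range]
      refine Finset.sum_congr rfl fun j _ => ?_
      simp only [p]
      rw [dif_pos j.2]
      rfl
  funext j
  ext1 v
  change iteratedFDeriv ℝ (j : ℕ) (jetPoly T.1) 0 v = _
  rw [hp.toHasFPowerSeriesOnBall.iteratedFDeriv_eq_sum_of_completeSpace]
  have h1 : ∀ σ : Equiv.Perm (Fin (j : ℕ)), p j (fun i => v (σ i)) =
      (((j : ℕ).factorial : ℝ)⁻¹) • T.1 j v := by
    intro σ
    simp only [p]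
    rw [dif_pos j.2]
    change (((j : ℕ).factorial : ℝ)⁻¹) • T.1 j (v ∘ σ) = _
    rw [T.2 j σ v]
  rw [Finset.sum_congr rfl fun σ _ => h1 σ, Finset.sum_const, Finset.card_univ,
    Fintype.card_perm, Fintype.card_fin, ← Nat.cast_smul_eq_nsmul ℝ, smul_smul,
    mul_inv_cancel₀ (by positivity), one_smul]

theorem jetOf_comp_sub (f : EuclideanSpace ℝ (Fin n) → EuclideanSpace ℝ (Fin q))
    (p x : EuclideanSpace ℝ (Fin n)) : jetOf r (fun y => f (y - p)) x = jetOf r f (x - p) :=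
  funext fun j => iteratedFDeriv_comp_sub (j : ℕ) p x

/-- Turns jets into sections with values in the subspace of symmetric tuples without losing
regularity: a continuous linear projection, which changes nothing where the map is of class `C^r`.
-/
theorem exists_proj_jetFiber (r n q : ℕ) :
    ∃ π : (∀ j : Fin (r + 1),
      EuclideanSpace ℝ (Fin n) [×(j : ℕ)]→L[ℝ] EuclideanSpace ℝ (Fin q)) →L[ℝ] JetFiber r n q,
      ∀ T : JetFiber r n q, π T = T := by
  have h : ∀ j : ℕ, FiniteDimensional ℝ
      (EuclideanSpace ℝ (Fin n) [×j]→L[ℝ] EuclideanSpace ℝ (Fin q)) := fun j =>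
    FiniteDimensional.of_injective
      ({ toFun := fun T => T.toMultilinearMap
         map_add' := fun _ _ => rfl
         map_smul' := fun _ _ => rfl } :
        (EuclideanSpace ℝ (Fin n) [×j]→L[ℝ] EuclideanSpace ℝ (Fin q)) →ₗ[ℝ]
          MultilinearMap ℝ (fun _ : Fin j => EuclideanSpace ℝ (Fin n)) (EuclideanSpace ℝ (Fin q)))
      ContinuousMultilinearMap.toMultilinearMap_injective
  have h2 : FiniteDimensional ℝ (∀ j : Fin (r + 1),
      EuclideanSpace ℝ (Fin n) [×(j : ℕ)]→L[ℝ] EuclideanSpace ℝ (Fin q)) := inferInstance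
  exact Submodule.ClosedComplemented.of_finiteDimensional (JetFiber r n q)

end Jets

/-! ### Nearest even and odd grid points -/

section Grid

/-- The even multiple of `1 / N` nearest to `t`. -/
noncomputable def evenNear (N : ℕ) (t : ℝ) : ℝ := 2 * round (N * t / 2) / N

/-- The odd multiple of `1 / N` nearest to `t`. -/
noncomputable def oddNear (N : ℕ) (t : ℝ) : ℝ := (2 * round ((N * t - 1) / 2) + 1) / N

theorem eventually_round_eq {w : ℝ} (h : ∀ j : ℤ, w + 1 / 2 ≠ j) :
    ∀ᶠ w' in 𝓝 w, round w' = round w := by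
  have h1 : (⌊w + 1 / 2⌋ : ℝ) < w + 1 / 2 := lt_of_le_of_ne (Int.floor_le _) (h _).symm
  have h2 : w + 1 / 2 < ⌊w + 1 / 2⌋ + 1 := Int.lt_floor_add_one _
  filter_upwards [lt_mem_nhds (show (⌊w + 1 / 2⌋ : ℝ) - 1 / 2 < w by linarith),
    gt_mem_nhds (show w < (⌊w + 1 / 2⌋ : ℝ) + 1 - 1 / 2 by linarith)] with w' h3 h4
  rw [round_eq, round_eq, Int.floor_eq_iff]
  constructor <;> linarith

theorem eventually_evenNear_eq {N : ℕ} {t : ℝ} (h : ∀ j : ℤ, (N : ℝ) * t ≠ 2 * j + 1) :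
    ∀ᶠ t' in 𝓝 t, evenNear N t' = evenNear N t := by
  have hc : Continuous fun t : ℝ => (N : ℝ) * t / 2 := by fun_prop
  have hr := (hc.tendsto t).eventually (eventually_round_eq (w := (N : ℝ) * t / 2) fun j hj =>
    h (j - 1) (by push_cast; linarith))
  filter_upwards [hr] with t' ht'
  rw [evenNear, evenNear, ht']

theorem eventually_oddNear_eq {N : ℕ} {t : ℝ} (h : ∀ j : ℤ, (N : ℝ) * t ≠ 2 * j) :
    ∀ᶠ t' in 𝓝 t, oddNear N t' = oddNear N t := by
  have hc : Continuous fun t : ℝ => ((N : ℝ) * t - 1) / 2 := by fun_prop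
  have hr := (hc.tendsto t).eventually (eventually_round_eq (w := ((N : ℝ) * t - 1) / 2) fun j hj =>
    h j (by linarith))
  filter_upwards [hr] with t' ht'
  rw [oddNear, oddNear, ht']

theorem abs_evenNear_sub_le {N : ℕ} (hN : 0 < N) (t : ℝ) : |evenNear N t - t| ≤ 1 / N := by
  have hN' : (0 : ℝ) < N := by exact_mod_cast hN
  have h := abs_sub_round ((N : ℝ) * t / 2)
  have : evenNear N t - t = 2 * (round ((N : ℝ) * t / 2) - (N : ℝ) * t / 2) / N := by
    rw [evenNear]; field_simp
  rw [this, abs_div, abs_of_pos hN']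
  gcongr
  rw [abs_mul, abs_two, abs_sub_comm]
  linarith

theorem abs_oddNear_sub_le {N : ℕ} (hN : 0 < N) (t : ℝ) : |oddNear N t - t| ≤ 1 / N := by
  have hN' : (0 : ℝ) < N := by exact_mod_cast hN
  have h := abs_sub_round (((N : ℝ) * t - 1) / 2)
  have : oddNear N t - t = 2 * (round (((N : ℝ) * t - 1) / 2) - ((N : ℝ) * t - 1) / 2) / N := by
    rw [oddNear]; field_simp; ring
  rw [this, abs_div, abs_of_pos hN']
  gcongr
  rw [abs_mul, abs_two, abs_sub_comm]
  linarith

theorem cos_pi_mul_odd (j : ℤ) : Real.cos (Real.pi * (2 * j + 1)) = -1 := by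
  rw [show Real.pi * (2 * j + 1) = j * (2 * Real.pi) + Real.pi by ring]
  exact Real.cos_int_mul_two_pi_add_pi j

theorem cos_pi_mul_even (j : ℤ) : Real.cos (Real.pi * (2 * j)) = 1 := by
  rw [show Real.pi * (2 * j) = j * (2 * Real.pi) by ring]
  exact Real.cos_int_mul_two_pi j

end Grid

/-! ### Box neighbourhoods of graphs over the cube -/

section Tubes

/-- The point of the cube `I^k` nearest to `p`. -/
noncomputable def cubeClip (k n : ℕ) (p : Fin n → ℝ) : EuclideanSpace ℝ (Fin n) :=
  WithLp.toLp 2 fun i => if (i : ℕ) < k then max 0 (min 1 (p i)) else 0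

/-- The box-shaped neighbourhood of size `ρ` of the graph of `φ` over the cube `I^k`. -/
def graphTube {k n : ℕ} (hkn : k < n) (ρ : ℝ) (φ : EuclideanSpace ℝ (Fin k) → ℝ) :
    Set (EuclideanSpace ℝ (Fin n)) :=
  {x | ∀ i : Fin n,
    |(if (i : ℕ) + 1 = n then x i - φ (firstCoords hkn x) else x i) - cubeClip k n x i| < ρ}

variable {k n : ℕ} {hkn : k < n} {ρ ρ' : ℝ} {φ φ' : EuclideanSpace ℝ (Fin k) → ℝ}

theorem graphTube_subset (h : ∀ y, |φ' y - φ y| + ρ' ≤ ρ) :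
    graphTube hkn ρ' φ' ⊆ graphTube hkn ρ φ := by
  intro x hx i
  have h1 := hx i
  have h2 := h (firstCoords hkn x)
  have h3 := abs_nonneg (φ' (firstCoords hkn x) - φ (firstCoords hkn x))
  split_ifs at h1 ⊢ with hi
  · rw [abs_lt] at h1 ⊢
    have := abs_le.1 (le_refl |φ' (firstCoords hkn x) - φ (firstCoords hkn x)|)
    constructor <;> linarith
  · linarith

theorem abs_last_sub_lt {x : EuclideanSpace ℝ (Fin n)} (hx : x ∈ graphTube hkn ρ φ) :
    |x ⟨n - 1, by omega⟩ - φ (firstCoords hkn x)| < ρ := by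
  have h := hx ⟨n - 1, by omega⟩
  have h1 : ¬ n - 1 < k := by omega
  have h2 : n - 1 + 1 = n := by omega
  simpa [cubeClip, h1, h2] using h

theorem contDiff_firstCoords : ContDiff ℝ ∞ (firstCoords hkn) := by
  unfold firstCoords
  fun_prop

theorem continuous_cubeClip : Continuous (cubeClip k n) := by
  unfold cubeClip
  refine (PiLp.continuous_toLp 2 _).comp (continuous_pi fun i => ?_)
  split_ifs <;> fun_prop

theorem isOpen_graphTube (hφ : Continuous φ) : IsOpen (graphTube hkn ρ φ) := by
  unfold graphTube
  simp only [ofPred_forall]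
  refine isOpen_iInter_of_finite fun i => ?_
  have h1 : Continuous fun x : EuclideanSpace ℝ (Fin n) => cubeClip k n x i :=
    (continuous_apply i).comp ((PiLp.continuous_ofLp 2 _).comp
      (continuous_cubeClip.comp (PiLp.continuous_ofLp 2 _)))
  have h2 : Continuous (firstCoords hkn) := contDiff_firstCoords.continuous
  refine isOpen_lt (Continuous.abs (Continuous.sub ?_ h1)) continuous_const
  split_ifs <;> fun_prop

end Tubes

/-! ### Fibrewise approximations and their blends -/

section FiberwiseApproximation

variable {k m n q r : ℕ} {s : ℕ∞}

/-- Data `φ`, `f` approximating the family of jets `F` near the graph of `φ`: the holonomic sections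
`J f_p` depend on `p` only through the coordinates of index at least `l`, and are close to `F` near the
slices where these coordinates are those of `p`. -/
structure FiberApprox (hkn : k < n) (s : ℕ∞) (r : ℕ) (S : Set (EuclideanSpace ℝ (Fin m)))
    (F : EuclideanSpace ℝ (Fin m) → EuclideanSpace ℝ (Fin n) → ∀ j : Fin (r + 1),
      EuclideanSpace ℝ (Fin n) [×(j : ℕ)]→L[ℝ] EuclideanSpace ℝ (Fin q))
    (K : Set (EuclideanSpace ℝ (Fin n)))
    (B : EuclideanSpace ℝ (Fin m) → EuclideanSpace ℝ (Fin n) → Prop)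
    (b : EuclideanSpace ℝ (Fin m) → EuclideanSpace ℝ (Fin n) → EuclideanSpace ℝ (Fin q))
    (l : ℕ) (ρ δ ε : ℝ) (φ : EuclideanSpace ℝ (Fin k) → ℝ)
    (f : (Fin n → ℝ) → EuclideanSpace ℝ (Fin m) → EuclideanSpace ℝ (Fin n) →
      EuclideanSpace ℝ (Fin q)) : Prop where
  subset : graphTube hkn ρ φ ⊆ K
  smooth : ContDiff ℝ ∞ φ
  small : ∀ y, |φ y| < δ
  reg : ∀ p, ∀ z ∈ S, ∀ x ∈ graphTube hkn ρ φ, JetRegAt s r S (f p) z x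
  modulus : ∀ η > 0, ∃ ν > 0, ∀ p p' : Fin n → ℝ, (∀ i, |p i - p' i| < ν) → ∀ z ∈ S,
    ∀ x ∈ graphTube hkn ρ φ, ‖jetOf r (f p z) x - jetOf r (f p' z) x‖ ≤ η
  close : ∀ p, ∀ z ∈ S, ∀ x ∈ graphTube hkn ρ φ,
    (∀ i : Fin n, l ≤ i → (i : ℕ) < k → |p i - x i| < ρ) → ‖jetOf r (f p z) x - F z x‖ < ε
  bdry : ∀ p, ∀ z ∈ S, ∀ x, B z x →
    (∀ i : Fin n, l ≤ i → (i : ℕ) < k → |p i - x i| < ρ) → f p z x = b z x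

/-- The interpolation between `f_p` for two neighbouring values of the coordinate `p_l`, depending on
the height. -/
noncomputable def gridBlend {Z : Type*} {n q : ℕ} (θ : EuclideanSpace ℝ (Fin n) → ℝ) (l : Fin n)
    (e o : ℝ) (f : (Fin n → ℝ) → Z → EuclideanSpace ℝ (Fin n) → EuclideanSpace ℝ (Fin q))
    (p : Fin n → ℝ) (z : Z) (x : EuclideanSpace ℝ (Fin n)) : EuclideanSpace ℝ (Fin q) :=
  (1 - θ x) • f (Function.update p l e) z x + θ x • f (Function.update p l o) z x

/-- Each of the two grid values is locally constant except where it jumps, and there its map has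
weight zero. So the grid values may be frozen near `x`, which makes the blend differentiable there.
-/
theorem eventually_gridBlend_eq {Z : Type*} {θ : EuclideanSpace ℝ (Fin n) → ℝ} {l : Fin n}
    {f : (Fin n → ℝ) → Z → EuclideanSpace ℝ (Fin n) → EuclideanSpace ℝ (Fin q)} {N : ℕ}
    {x : EuclideanSpace ℝ (Fin n)}
    (h1 : (∃ j : ℤ, (N : ℝ) * x l = 2 * j + 1) → ∀ᶠ y in 𝓝 x, θ y = 1)
    (h0 : (∃ j : ℤ, (N : ℝ) * x l = 2 * j) → ∀ᶠ y in 𝓝 x, θ y = 0) :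
    ∀ᶠ y in 𝓝 x, ∀ p z, gridBlend θ l (evenNear N (x l)) (oddNear N (x l)) f p z y =
      gridBlend θ l (evenNear N (y l)) (oddNear N (y l)) f p z y := by
  have hc : Continuous fun y : EuclideanSpace ℝ (Fin n) => y l := by fun_prop
  have he : ∀ᶠ y in 𝓝 x, evenNear N (x l) = evenNear N (y l) ∨ θ y = 1 := by
    by_cases h : ∃ j : ℤ, (N : ℝ) * x l = 2 * j + 1
    · exact (h1 h).mono fun y hy => Or.inr hy
    · push Not at h
      exact ((hc.tendsto x).eventually (eventually_evenNear_eq h)).mono fun y hy => Or.inl hy.symm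
  have ho : ∀ᶠ y in 𝓝 x, oddNear N (x l) = oddNear N (y l) ∨ θ y = 0 := by
    by_cases h : ∃ j : ℤ, (N : ℝ) * x l = 2 * j
    · exact (h0 h).mono fun y hy => Or.inr hy
    · push Not at h
      exact ((hc.tendsto x).eventually (eventually_oddNear_eq h)).mono fun y hy => Or.inl hy.symm
  filter_upwards [he, ho] with y hye hyo p z
  unfold gridBlend
  congr 1
  · rcases hye with h | h
    · rw [h]
    · rw [h, sub_self, zero_smul, zero_smul]
  · rcases hyo with h | h
    · rw [h]
    · rw [h, zero_smul, zero_smul]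

end FiberwiseApproximation

/-! ### Removing the dependence on the cube coordinates -/

section FiberwiseStep

variable {k m n q r : ℕ} {s : ℕ∞}

theorem update_near {p p' : Fin n → ℝ} {l : Fin n} {e ν : ℝ} (hν : 0 < ν)
    (h : ∀ i, |p i - p' i| < ν) (i : Fin n) :
    |Function.update p l e i - Function.update p' l e i| < ν := by
  by_cases hi : i = l
  · subst hi; simpa using hν
  · simpa [Function.update_of_ne hi] using h i

theorem update_near_slice {p : Fin n → ℝ} {x : EuclideanSpace ℝ (Fin n)} {l : Fin n} {e ρ ρ' : ℝ}
    (he : |e - x l| < ρ) (hρ : ρ' ≤ ρ)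
    (hp : ∀ i : Fin n, (l : ℕ) + 1 ≤ i → (i : ℕ) < k → |p i - x i| < ρ') (i : Fin n)
    (hi : (l : ℕ) ≤ i) (hik : (i : ℕ) < k) : |Function.update p l e i - x i| < ρ := by
  by_cases h : i = l
  · subst h; simpa using he
  · rw [Function.update_of_ne h]
    have : (l : ℕ) ≠ i := fun h' => h (Fin.ext h'.symm)
    exact (hp i (by omega) hik).trans_le hρ

/-- Interpolating between the points of a fine grid removes the dependence on one more coordinate. -/
theorem FiberApprox.step {hkn : k < n} {S : Set (EuclideanSpace ℝ (Fin m))}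
    {F : EuclideanSpace ℝ (Fin m) → EuclideanSpace ℝ (Fin n) → ∀ j : Fin (r + 1),
      EuclideanSpace ℝ (Fin n) [×(j : ℕ)]→L[ℝ] EuclideanSpace ℝ (Fin q)}
    {K : Set (EuclideanSpace ℝ (Fin n))} (hK : IsCompact K)
    {B : EuclideanSpace ℝ (Fin m) → EuclideanSpace ℝ (Fin n) → Prop}
    {b : EuclideanSpace ℝ (Fin m) → EuclideanSpace ℝ (Fin n) → EuclideanSpace ℝ (Fin q)}
    {l : ℕ} (hl : l < k) {ρ δ ε δ' ε' : ℝ} (hρ : 0 < ρ) (hδ : δ < δ') (hε : ε < ε')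
    {φ : EuclideanSpace ℝ (Fin k) → ℝ}
    {f : (Fin n → ℝ) → EuclideanSpace ℝ (Fin m) → EuclideanSpace ℝ (Fin n) →
      EuclideanSpace ℝ (Fin q)}
    (hf : FiberApprox hkn s r S F K B b l ρ δ ε φ f) :
    ∃ ρ' φ' f', 0 < ρ' ∧ ρ' ≤ ρ ∧ FiberApprox hkn s r S F K B b (l + 1) ρ' δ' ε' φ' f' := by
  -- The graph will move by at most `2 * a` and its tube will have size `a / 2`; the bounds on `a`
  -- keep this tube in the old one and the height below `δ'`.
  obtain ⟨a, ha, ha1, ha2⟩ : ∃ a > 0, a ≤ ρ / 8 ∧ a ≤ (δ' - δ) / 4 :=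
    ⟨min (ρ / 8) ((δ' - δ) / 4), lt_min (by linarith) (by linarith), min_le_left _ _,
      min_le_right _ _⟩
  let L : Fin n := ⟨l, by omega⟩
  let τ : EuclideanSpace ℝ (Fin n) → ℝ := fun x =>
    (x ⟨n - 1, by omega⟩ - φ (firstCoords hkn x)) / a
  let θ : EuclideanSpace ℝ (Fin n) → ℝ := fun x => Real.smoothTransition (τ x)
  have hτ : ContDiff ℝ ∞ τ := by
    have h1 : ContDiff ℝ ∞ fun x => φ (firstCoords hkn x) := hf.smooth.comp contDiff_firstCoords
    have h2 : ContDiff ℝ ∞ fun x : EuclideanSpace ℝ (Fin n) => x ⟨n - 1, by omega⟩ := by fun_prop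
    exact (h2.sub h1).div_const _
  have hθ : ContDiff ℝ ∞ θ := Real.smoothTransition.contDiff.comp hτ
  have hθ' : ContDiff ℝ ∞ fun x => 1 - θ x := contDiff_const.sub hθ
  -- The constants depend on `a` and `φ` but not on `N`, which is chosen below. With `ν` belonging
  -- to `(ε' - ε) / (2 * C)`, the blend costs at most `(ε' - ε) / 2`.
  obtain ⟨C, hC, hCθ⟩ := norm_jetOf_smul_le r q hθ hK
  obtain ⟨C', hC', hCθ'⟩ := norm_jetOf_smul_le r q hθ' hK
  obtain ⟨ν, hν, hνf⟩ := hf.modulus ((ε' - ε) / (2 * C)) (div_pos (by linarith) (by linarith))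
  -- The bound `2 / ν` brings the two grid values, at most `2 / N` apart, within `ν`; the bound `1 /
  -- ρ` puts both within `ρ` of the coordinate of `x`.
  obtain ⟨N, hN⟩ := exists_nat_gt (max (2 / ν) (1 / ρ))
  have hN0' : (0 : ℝ) < N := (by positivity : (0 : ℝ) < 1 / ρ).trans
    ((le_max_right _ _).trans_lt hN)
  have hN0 : 0 < N := by exact_mod_cast hN0'
  have hNν : 2 / (N : ℝ) < ν := by
    have := (le_max_left _ _).trans_lt hN
    rw [div_lt_iff₀ hν] at this
    rw [div_lt_iff₀ hN0']
    linarith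
  have hNρ : 1 / (N : ℝ) < ρ := by
    have := (le_max_right _ _).trans_lt hN
    rw [div_lt_iff₀ hρ] at this
    rw [div_lt_iff₀ hN0']
    linarith
  let φ' : EuclideanSpace ℝ (Fin k) → ℝ := fun y =>
    φ y - 2 * a * Real.cos (Real.pi * (N * y ⟨l, hl⟩))
  have hφφ' : ∀ y, |φ' y - φ y| ≤ 2 * a := by
    intro y
    have h1 := Real.neg_one_le_cos (Real.pi * (N * y ⟨l, hl⟩))
    have h2 := Real.cos_le_one (Real.pi * (N * y ⟨l, hl⟩))
    simp only [φ']
    rw [abs_le]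
    constructor <;> nlinarith
  have hsub : graphTube hkn (a / 2) φ' ⊆ graphTube hkn ρ φ :=
    graphTube_subset fun y => by linarith [hφφ' y]
  let f' : (Fin n → ℝ) → EuclideanSpace ℝ (Fin m) → EuclideanSpace ℝ (Fin n) →
      EuclideanSpace ℝ (Fin q) := fun p z x =>
    gridBlend θ L (evenNear N (x L)) (oddNear N (x L)) f p z x
  -- For odd `N * x L` the tube lies above `φ + 3 * a / 2`, where `θ = 1`; for even `N * x L` it
  -- lies below `φ - 3 * a / 2`, where `θ = 0`.
  have hloc : ∀ x ∈ graphTube hkn (a / 2) φ', ∀ᶠ y in 𝓝 x, ∀ p z,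
      gridBlend θ L (evenNear N (x L)) (oddNear N (x L)) f p z y = f' p z y := by
    intro x hx
    have hx1 := abs_lt.1 (abs_last_sub_lt hx)
    have hφx : φ' (firstCoords hkn x) =
        φ (firstCoords hkn x) - 2 * a * Real.cos (Real.pi * (N * x L)) := rfl
    refine eventually_gridBlend_eq ?_ ?_
    · rintro ⟨j, hj⟩
      rw [hj, cos_pi_mul_odd] at hφx
      have : 1 < τ x := by
        rw [lt_div_iff₀ ha]
        linarith
      filter_upwards [(hτ.continuous.tendsto x).eventually (lt_mem_nhds this)] with y hy
      exact Real.smoothTransition.one_of_one_le hy.le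
    · rintro ⟨j, hj⟩
      rw [hj, cos_pi_mul_even] at hφx
      have : τ x < 0 := by
        rw [div_lt_iff₀ ha]
        linarith
      filter_upwards [(hτ.continuous.tendsto x).eventually (gt_mem_nhds this)] with y hy
      exact Real.smoothTransition.zero_of_nonpos hy.le
  have hcd : ∀ p, ∀ z ∈ S, ∀ x ∈ graphTube hkn (a / 2) φ', ContDiffAt ℝ r (f p z) x :=
    fun p z hz x hx => (hf.reg p z hz x (hsub hx)).contDiffAt hz
  have hcdθ : ∀ x, ContDiffAt ℝ r θ x := fun x =>
    hθ.contDiffAt.of_le (by exact_mod_cast le_top)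
  have hcdθ' : ∀ x, ContDiffAt ℝ r (fun x => 1 - θ x) x := fun x =>
    hθ'.contDiffAt.of_le (by exact_mod_cast le_top)
  have hjet : ∀ p z, ∀ x ∈ graphTube hkn (a / 2) φ', jetOf r (f' p z) x =
      jetOf r (gridBlend θ L (evenNear N (x L)) (oddNear N (x L)) f p z) x := fun p z x hx =>
    jetOf_congr ((hloc x hx).mono fun y hy => (hy p z).symm)
  refine ⟨a / 2, φ', f', by linarith, by linarith, hsub.trans hf.subset, ?_, ?_, ?_, ?_, ?_, ?_⟩
  · refine hf.smooth.sub (contDiff_const.mul (Real.contDiff_cos.comp ?_))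
    fun_prop
  · intro y
    have h1 := abs_lt.1 (hf.small y)
    have h2 := abs_le.1 (hφφ' y)
    rw [abs_lt]
    constructor <;> linarith
  · intro p z hz x hx
    have h1 := (jetRegAt_of_contDiff_const (s := s) (r := r) (S := S) (z := z) (x := x) hθ').smul
      (hf.reg (Function.update p L (evenNear N (x L))) z hz x (hsub hx)) hz
    have h2 := (jetRegAt_of_contDiff_const (s := s) (r := r) (S := S) (z := z) (x := x) hθ).smul
      (hf.reg (Function.update p L (oddNear N (x L))) z hz x (hsub hx)) hz
    refine (h1.add h2 hz).congr hz ?_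
    have h3 := (continuous_snd.tendsto (z, x)).eventually (hloc x hx)
    exact (h3.filter_mono nhdsWithin_le_nhds).mono fun w hw => hw p w.1
  · intro η hη
    obtain ⟨ν', hν', h⟩ := hf.modulus (η / (C + C')) (div_pos hη (by linarith))
    refine ⟨ν', hν', fun p p' hp z hz x hx => ?_⟩
    have hxK := hf.subset (hsub hx)
    set e := evenNear N (x L) with he
    set o := oddNear N (x L) with ho
    have c1 := hcd (Function.update p L e) z hz x hx
    have c2 := hcd (Function.update p' L e) z hz x hx
    have c3 := hcd (Function.update p L o) z hz x hx
    have c4 := hcd (Function.update p' L o) z hz x hx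
    have key : jetOf r (f' p z) x - jetOf r (f' p' z) x =
        jetOf r (fun y => (1 - θ y) • (f (Function.update p L e) z y -
          f (Function.update p' L e) z y)) x +
        jetOf r (fun y => θ y • (f (Function.update p L o) z y -
          f (Function.update p' L o) z y)) x := by
      rw [hjet p z x hx, hjet p' z x hx, ← jetOf_sub, ← jetOf_add]
      · congr 1
        funext y
        simp only [gridBlend, smul_sub]
        abel
      · exact (hcdθ' x).smul (c1.sub c2)
      · exact (hcdθ x).smul (c3.sub c4)
      · exact ((hcdθ' x).smul c1).add ((hcdθ x).smul c3)
      · exact ((hcdθ' x).smul c2).add ((hcdθ x).smul c4)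
    rw [key]
    have e1 := hCθ' x hxK _ (c1.sub c2)
    have e2 := hCθ x hxK _ (c3.sub c4)
    rw [jetOf_sub c1 c2] at e1
    rw [jetOf_sub c3 c4] at e2
    have e3 := h _ _ (update_near (l := L) (e := e) hν' hp) z hz x (hsub hx)
    have e4 := h _ _ (update_near (l := L) (e := o) hν' hp) z hz x (hsub hx)
    refine (norm_add_le _ _).trans ?_
    refine (add_le_add (e1.trans (mul_le_mul_of_nonneg_left e3 hC'.le))
      (e2.trans (mul_le_mul_of_nonneg_left e4 hC.le))).trans (le_of_eq ?_)
    field_simp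
    ring
  · intro p z hz x hx hp
    have hxK := hf.subset (hsub hx)
    set e := evenNear N (x L) with he
    set o := oddNear N (x L) with ho
    have he' : |e - x L| ≤ 1 / N := abs_evenNear_sub_le hN0 _
    have ho' : |o - x L| ≤ 1 / N := abs_oddNear_sub_le hN0 _
    have c1 := hcd (Function.update p L e) z hz x hx
    have c3 := hcd (Function.update p L o) z hz x hx
    -- The map of the even grid value is already `ε`-close, and the correction is `θ` times a
    -- difference with small jet.
    have key : jetOf r (f' p z) x = jetOf r (f (Function.update p L e) z) x +
        jetOf r (fun y => θ y • (f (Function.update p L o) z y -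
          f (Function.update p L e) z y)) x := by
      rw [hjet p z x hx, ← jetOf_add]
      · congr 1
        funext y
        simp only [gridBlend, smul_sub, sub_smul, one_smul]
        abel
      · exact c1
      · exact (hcdθ x).smul (c3.sub c1)
    have e1 := hCθ x hxK _ (c3.sub c1)
    rw [jetOf_sub c3 c1] at e1
    have hoe : ∀ i, |Function.update p L o i - Function.update p L e i| < ν := by
      intro i
      by_cases hi : i = L
      · subst hi
        simp only [Function.update_self]
        have h5 := abs_le.1 he'
        have h6 := abs_le.1 ho'
        have h7 : (2 : ℝ) / N = 1 / N + 1 / N := by ring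
        rw [abs_lt]
        constructor <;> linarith
      · simpa [Function.update_of_ne hi] using hν
    have e2 := hνf _ _ hoe z hz x (hsub hx)
    have e3 := hf.close (Function.update p L e) z hz x (hsub hx)
      (update_near_slice (he'.trans_lt hNρ) (by linarith) hp)
    have e4 : C * ((ε' - ε) / (2 * C)) = (ε' - ε) / 2 := by field_simp
    have e5 := e1.trans (mul_le_mul_of_nonneg_left e2 hC.le)
    rw [key, add_sub_right_comm]
    refine (norm_add_le _ _).trans_lt ?_
    linarith
  · intro p z hz x hx hp
    have he' : |evenNear N (x L) - x L| ≤ 1 / N := abs_evenNear_sub_le hN0 _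
    have ho' : |oddNear N (x L) - x L| ≤ 1 / N := abs_oddNear_sub_le hN0 _
    have e1 := hf.bdry (Function.update p L (evenNear N (x L))) z hz x hx
      (update_near_slice (he'.trans_lt hNρ) (by linarith) hp)
    have e2 := hf.bdry (Function.update p L (oddNear N (x L))) z hz x hx
      (update_near_slice (ho'.trans_lt hNρ) (by linarith) hp)
    -- Both maps equal `b` at `x` and the weights add up to one.
    simp only [f', gridBlend]
    rw [e1, e2, ← add_smul, sub_add_cancel, one_smul]

/-- Removing the dependence on all coordinates. -/
theorem FiberApprox.exists_full {hkn : k < n} {S : Set (EuclideanSpace ℝ (Fin m))}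
    {F : EuclideanSpace ℝ (Fin m) → EuclideanSpace ℝ (Fin n) → ∀ j : Fin (r + 1),
      EuclideanSpace ℝ (Fin n) [×(j : ℕ)]→L[ℝ] EuclideanSpace ℝ (Fin q)}
    {K : Set (EuclideanSpace ℝ (Fin n))} (hK : IsCompact K)
    {B : EuclideanSpace ℝ (Fin m) → EuclideanSpace ℝ (Fin n) → Prop}
    {b : EuclideanSpace ℝ (Fin m) → EuclideanSpace ℝ (Fin n) → EuclideanSpace ℝ (Fin q)}
    {ρ δ ε : ℝ} (hρ : 0 < ρ) {φ : EuclideanSpace ℝ (Fin k) → ℝ}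
    {f : (Fin n → ℝ) → EuclideanSpace ℝ (Fin m) → EuclideanSpace ℝ (Fin n) →
      EuclideanSpace ℝ (Fin q)}
    (hf : FiberApprox hkn s r S F K B b 0 ρ δ ε φ f) (l : ℕ) (hl : l ≤ k) :
    ∀ δ' > δ, ∀ ε' > ε, ∃ ρ' φ' f', 0 < ρ' ∧ ρ' ≤ ρ ∧
      FiberApprox hkn s r S F K B b l ρ' δ' ε' φ' f' := by
  induction l with
  | zero =>
    intro δ' hδ ε' hε
    exact ⟨ρ, φ, f, hρ, le_rfl, hf.subset, hf.smooth, fun y => (hf.small y).trans hδ, hf.reg,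
      hf.modulus, fun p z hz x hx hp => (hf.close p z hz x hx hp).trans hε, hf.bdry⟩
  | succ l ih =>
    intro δ' hδ ε' hε
    obtain ⟨ρ₁, φ₁, f₁, h1, h2, h3⟩ := ih (by omega) ((δ + δ') / 2) (by linarith)
      ((ε + ε') / 2) (by linarith)
    obtain ⟨ρ₂, φ₂, f₂, h4, h5, h6⟩ := h3.step hK (by omega : l < k) h1
      (by linarith : (δ + δ') / 2 < δ') (by linarith : (ε + ε') / 2 < ε')
    exact ⟨ρ₂, φ₂, f₂, h4, h5.trans h2, h6⟩

end FiberwiseStep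

/-! ### Cutoffs, cubes and clipping -/

section Cubes

variable {k n : ℕ}

theorem exists_contDiff_bump {X : Type*} [NormedAddCommGroup X] [NormedSpace ℝ X]
    [FiniteDimensional ℝ X] {C O : Set X} (hC : IsClosed C) (hO : IsOpen O) (h : C ⊆ O) :
    ∃ c : X → ℝ, ContDiff ℝ ∞ c ∧ (∀ x, c x ∈ Icc (0 : ℝ) 1) ∧ tsupport c ⊆ O ∧
      ∃ V, IsOpen V ∧ C ⊆ V ∧ V ⊆ O ∧ ∀ x ∈ V, c x = 1 := by
  obtain ⟨u, hu, hCu, huO⟩ := normal_exists_closure_subset hC hO h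
  obtain ⟨f, h1, h0, hf⟩ := exists_contMDiffMap_one_nhds_of_subset_interior (n := (⊤ : ℕ∞))
    (modelWithCornersSelf ℝ X) hC (hu.interior_eq.symm ▸ hCu : C ⊆ interior u)
  obtain ⟨V, hV, hCV, hV1⟩ := eventually_nhdsSet_iff_exists.1 h1
  have hsupp : Function.support f ⊆ u := fun x hx => by_contra fun hxu => hx (h0 x hxu)
  refine ⟨f, f.contMDiff.contDiff, hf, (closure_mono hsupp).trans huO, V, hV, hCV, ?_, hV1⟩
  intro x hx
  refine huO (subset_closure (hsupp ?_))
  rw [Function.mem_support, hV1 x hx]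
  exact one_ne_zero

theorem isCompact_stdCube (k n : ℕ) : IsCompact (stdCube k n) := by
  have h : IsCompact (Set.pi univ fun i : Fin n =>
      if (i : ℕ) < k then Icc (0 : ℝ) 1 else {0}) :=
    isCompact_univ_pi fun i => by split_ifs <;> [exact isCompact_Icc; exact isCompact_singleton]
  have h2 := h.image (PiLp.continuous_toLp 2 fun _ : Fin n => ℝ)
  convert! h2 using 1
  ext x
  constructor
  · intro hx
    refine ⟨x.ofLp, fun i _ => ?_, rfl⟩
    have := hx i
    split_ifs at this ⊢ with hi
    · simpa [hi] using this
    · simpa [hi] using this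
  · rintro ⟨y, hy, rfl⟩ i
    have := hy i (mem_univ i)
    split_ifs with hi
    · simpa [hi] using this
    · simpa [hi] using this

theorem isClosed_stdCubeBdry (k n : ℕ) : IsClosed (stdCubeBdry k n) := by
  have h : IsClosed (⋃ i : Fin n, {x : EuclideanSpace ℝ (Fin n) | (i : ℕ) < k ∧
      (x i = 0 ∨ x i = 1)}) := by
    refine isClosed_iUnion_of_finite fun i => ?_
    have hc : Continuous fun y : EuclideanSpace ℝ (Fin n) => y i := by fun_prop
    have h1 : IsClosed {x : EuclideanSpace ℝ (Fin n) | x i = 0 ∨ x i = 1} :=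
      (isClosed_eq hc continuous_const).union (isClosed_eq hc continuous_const)
    by_cases hi : (i : ℕ) < k
    · simpa [hi] using h1
    · simp [hi]
  convert! (isCompact_stdCube k n).isClosed.inter h using 1
  ext x
  simp [stdCubeBdry]

theorem stdCubeBdry_subset : stdCubeBdry k n ⊆ stdCube k n := fun _ hx => hx.1

theorem cubeClip_mem (p : Fin n → ℝ) : cubeClip k n p ∈ stdCube k n := by
  intro i
  split_ifs with hi <;> simp [cubeClip, hi]

theorem cubeClip_of_mem {x : EuclideanSpace ℝ (Fin n)} (hx : x ∈ stdCube k n) :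
    cubeClip k n x = x := by
  ext i
  have := hx i
  by_cases hi : (i : ℕ) < k
  · rw [if_pos hi] at this
    simp [cubeClip, hi, this.1, this.2]
  · rw [if_neg hi] at this
    simp [cubeClip, hi, this]

theorem abs_cubeClip_sub_le {p p' : Fin n → ℝ} {ρ : ℝ} (hρ : 0 < ρ)
    (h : ∀ i : Fin n, (i : ℕ) < k → |p i - p' i| < ρ) (i : Fin n) :
    |cubeClip k n p i - cubeClip k n p' i| < ρ := by
  by_cases hi : (i : ℕ) < k
  · simp only [cubeClip, hi, if_true]
    refine lt_of_le_of_lt ((abs_max_sub_max_le_max _ _ _ _).trans (max_le (by simp) ?_)) (h i hi)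
    exact (abs_min_sub_min_le_max _ _ _ _).trans (max_le (by simp) le_rfl)
  · simpa [cubeClip, hi] using hρ

theorem exists_forall_dist_lt (n : ℕ) {ν : ℝ} (hν : 0 < ν) :
    ∃ ρ > 0, ∀ x y : EuclideanSpace ℝ (Fin n), (∀ i, |x i - y i| < ρ) → dist x y < ν := by
  have h := PiLp.uniformContinuous_toLp 2 fun _ : Fin n => ℝ
  obtain ⟨ρ, hρ, h⟩ := Metric.uniformContinuous_iff.1 h ν hν
  refine ⟨ρ, hρ, fun x y hxy => ?_⟩
  exact h (a := x.ofLp) (b := y.ofLp) ((dist_pi_lt_iff hρ).2 fun i => by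
    rw [Real.dist_eq]; exact hxy i)

theorem mem_graphTube_zero {hkn : k < n} {ρ : ℝ} {x : EuclideanSpace ℝ (Fin n)} :
    x ∈ graphTube hkn ρ (fun _ => 0) ↔ ∀ i, |x i - cubeClip k n x i| < ρ := by
  simp [graphTube]

end Cubes

/-! ### The initial fibrewise approximation -/

section Base

variable {k m n q r : ℕ} {s : ℕ∞}

/-- The map with the prescribed jet `T` at `p`, blended with the map `b`. -/
noncomputable def blendedTaylor
    (F : EuclideanSpace ℝ (Fin m) → EuclideanSpace ℝ (Fin n) → JetFiber r n q)
    (c : EuclideanSpace ℝ (Fin m) → EuclideanSpace ℝ (Fin n) → ℝ)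
    (b : EuclideanSpace ℝ (Fin m) → EuclideanSpace ℝ (Fin n) → EuclideanSpace ℝ (Fin q))
    (p : EuclideanSpace ℝ (Fin n)) (z : EuclideanSpace ℝ (Fin m)) (x : EuclideanSpace ℝ (Fin n)) :
    EuclideanSpace ℝ (Fin q) :=
  (1 - c z p) • jetPoly (F z p).1 (x - p) + c z p • b z x

variable {S : Set (EuclideanSpace ℝ (Fin m))} {U : Set (EuclideanSpace ℝ (Fin n))}
  {F : EuclideanSpace ℝ (Fin m) → EuclideanSpace ℝ (Fin n) → JetFiber r n q}
  {c : EuclideanSpace ℝ (Fin m) → EuclideanSpace ℝ (Fin n) → ℝ}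
  {b : EuclideanSpace ℝ (Fin m) → EuclideanSpace ℝ (Fin n) → EuclideanSpace ℝ (Fin q)}

/-- The base point may vary with the parameter `w`. With `p` constant this gives the regularity in
`z`; with the pair `(z, p)` as parameter and `s' = 0` it gives the continuity in `p`. -/
theorem jetRegAt_blendedTaylor {Z : Type} [NormedAddCommGroup Z] [NormedSpace ℝ Z] {s' : ℕ∞}
    (hs : s' ≤ s) (hF : IsSectionFamily s S (univ ×ˢ U) F)
    (hc : ContDiff ℝ ∞ (Function.uncurry c)) (hb : ∀ z ∈ S, ∀ x ∈ U, JetRegAt s r S b z x)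
    {T : Set Z} {ζ : Z → EuclideanSpace ℝ (Fin m)} {p : Z → EuclideanSpace ℝ (Fin n)} {w : Z}
    (hw : w ∈ T) (hζ : ContDiffWithinAt ℝ s' ζ T w) (hp : ContDiffWithinAt ℝ s' p T w)
    (hζS : MapsTo ζ T S) (hpU : MapsTo p T U) {x : EuclideanSpace ℝ (Fin n)} (hx : x ∈ U) :
    JetRegAt s' r T (fun w => blendedTaylor F c b (p w) (ζ w)) w x := by
  have hcz : ContDiffWithinAt ℝ s' (fun w => c (ζ w) (p w)) T w :=
    (hc.of_le (by exact_mod_cast le_top)).comp_contDiffWithinAt (hζ.prodMk hp)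
  have hFz : ContDiffWithinAt ℝ s' (fun w => (F (ζ w) (p w)).1) T w := by
    have h1 : ContDiffWithinAt ℝ s' (Function.uncurry F)
        {w | w ∈ univ ×ˢ U ∧ w.1 ∈ S} (ζ w, p w) :=
      (hF (ζ w, p w) ⟨⟨mem_univ _, hpU hw⟩, hζS hw⟩).of_le (by exact_mod_cast hs)
    have hm : MapsTo (fun w => (ζ w, p w)) T {w | w ∈ univ ×ˢ U ∧ w.1 ∈ S} :=
      fun w hw => ⟨⟨mem_univ _, hpU hw⟩, hζS hw⟩
    have h2 : ContDiffWithinAt ℝ s' (fun w => F (ζ w) (p w)) T w :=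
      ContDiffWithinAt.comp (g := Function.uncurry F) (f := fun w => (ζ w, p w)) w h1
        (hζ.prodMk hp) hm
    exact (JetFiber r n q).subtypeL.contDiff.comp_contDiffWithinAt h2
  have h1 : JetRegAt s' r T (fun w x => jetPoly (F (ζ w) (p w)).1 (x - p w)) w x := by
    refine jetRegAt_of_contDiff (Ψ := fun (T : (∀ j : Fin (r + 1),
      EuclideanSpace ℝ (Fin n) [×(j : ℕ)]→L[ℝ] EuclideanSpace ℝ (Fin q)) ×
      EuclideanSpace ℝ (Fin n)) x => jetPoly T.1 (x - T.2))
      (a := fun w => ((F (ζ w) (p w)).1, p w)) ?_ (hFz.prodMk hp)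
    exact contDiff_uncurry_jetPoly.comp ((contDiff_fst.comp contDiff_fst).prodMk
      (contDiff_snd.sub (contDiff_snd.comp contDiff_fst)))
  have h2 : JetRegAt s' r T (fun w => b (ζ w)) w x :=
    ((hb (ζ w) (hζS hw) x hx).of_le hs).comp_param hζ hζS
  exact ((jetRegAt_of_contDiffWithinAt (contDiffWithinAt_const.sub hcz)).smul h1 hw).add
    ((jetRegAt_of_contDiffWithinAt hcz).smul h2 hw) hw

/-- The blend is the Taylor polynomial plus `c z p` times its difference from `b z`. Either the
weight vanishes, or both maps have jet `F z p` at `p` and the difference has jet zero. -/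
theorem jetOf_blendedTaylor_self {p : EuclideanSpace ℝ (Fin n)} {z : EuclideanSpace ℝ (Fin m)}
    (hb : ContDiffAt ℝ r (b z) p) (hcb : c z p ≠ 0 → jetOf r (b z) p = (F z p).1) :
    jetOf r (blendedTaylor F c b p z) p = (F z p).1 := by
  have h1 : ContDiff ℝ ∞ fun y => jetPoly (F z p).1 (y - p) :=
    contDiff_uncurry_jetPoly.comp (contDiff_const.prodMk (contDiff_id.sub contDiff_const))
  have h2 : ContDiffAt ℝ r (fun y => jetPoly (F z p).1 (y - p)) p :=
    h1.contDiffAt.of_le (by exact_mod_cast le_top)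
  have h3 : jetOf r (fun y => jetPoly (F z p).1 (y - p)) p = (F z p).1 := by
    rw [jetOf_comp_sub, sub_self, jetOf_jetPoly_zero]
  by_cases h : c z p = 0
  · have : blendedTaylor F c b p z = fun y => jetPoly (F z p).1 (y - p) := by
      funext y
      simp [blendedTaylor, h]
    rw [this, h3]
  · have h4 : ContDiffAt ℝ r (fun y => b z y - jetPoly (F z p).1 (y - p)) p := hb.sub h2
    have h5 : jetOf r (fun y => b z y - jetPoly (F z p).1 (y - p)) p = 0 := by
      rw [jetOf_sub hb h2, h3, hcb h, sub_self]
    have h6 := jetOf_smul_eq_zero (θ := fun _ => c z p) contDiff_const h4 h5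
    have : blendedTaylor F c b p z = fun y => jetPoly (F z p).1 (y - p) +
        c z p • (b z y - jetPoly (F z p).1 (y - p)) := by
      funext y
      simp only [blendedTaylor, sub_smul, one_smul, smul_sub]
      abel
    have h7 : ContDiffAt ℝ r (fun y => c z p • (b z y - jetPoly (F z p).1 (y - p))) p :=
      h4.const_smul (c z p)
    rw [this, jetOf_add h2 h7, h6, add_zero, h3]

theorem continuousOn_jetOf_blendedTaylor
    (hF : IsSectionFamily s S (univ ×ˢ U) F) (hc : ContDiff ℝ ∞ (Function.uncurry c))
    (hb : ∀ z ∈ S, ∀ x ∈ U, JetRegAt s r S b z x) :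
    ContinuousOn (fun w : (EuclideanSpace ℝ (Fin m) × EuclideanSpace ℝ (Fin n)) ×
      EuclideanSpace ℝ (Fin n) => jetOf r (blendedTaylor F c b w.1.2 w.1.1) w.2)
      ((S ×ˢ U) ×ˢ U) := by
  refine continuousOn_pi.2 fun j w hw => ?_
  have h := jetRegAt_blendedTaylor (s' := 0) (T := S ×ˢ U) (ζ := Prod.fst) (p := Prod.snd)
    (w := w.1) (by simp) hF hc hb hw.1 contDiffWithinAt_fst contDiffWithinAt_snd
    (fun w hw => hw.1) (fun w hw => hw.2) hw.2
  exact (h.2 j (Nat.le_of_lt_succ j.2)).continuousWithinAt.mono (prod_mono_right (subset_univ _))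

/-- Blended Taylor polynomials approximate a family of jets near the cube fibrewise. -/
theorem exists_fiberApprox_zero (hkn : k < n) (hS : IsCompact S) (hU : IsOpen U)
    (hcube : stdCube k n ⊆ U) (hF : IsSectionFamily s S (univ ×ˢ U) F)
    (hc : ContDiff ℝ ∞ (Function.uncurry c)) (hb : ∀ z ∈ S, ∀ x ∈ U, JetRegAt s r S b z x)
    (hcb : ∀ z ∈ S, ∀ x ∈ stdCube k n, c z x ≠ 0 → jetOf r (b z) x = (F z x).1)
    {B : EuclideanSpace ℝ (Fin m) → EuclideanSpace ℝ (Fin n) → Prop} {κ : ℝ} (hκ : 0 < κ)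
    (hB : ∀ z ∈ S, ∀ x, B z x → ∀ p : Fin n → ℝ,
      (∀ i : Fin n, (i : ℕ) < k → |p i - x i| < κ) → c z (cubeClip k n p) = 1) :
    ∃ K ⊆ U, IsCompact K ∧ ∀ δ > 0, ∀ ε > 0, ∃ ρ > 0, ρ ≤ δ ∧
      FiberApprox hkn s r S (fun z x => (F z x).1) K B b 0 ρ δ ε (fun _ => 0)
        (fun p => blendedTaylor F c b (cubeClip k n p)) := by
  obtain ⟨d, hd, hdU⟩ := (isCompact_stdCube k n).exists_cthickening_subset_open hU hcube
  have hKc : IsCompact (Metric.cthickening d (stdCube k n)) := (isCompact_stdCube k n).cthickening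
  refine ⟨_, hdU, hKc, fun δ hδ ε hε => ?_⟩
  set K := Metric.cthickening d (stdCube k n) with hKdef
  have hcubeK : stdCube k n ⊆ K := Metric.self_subset_cthickening _
  have hG := continuousOn_jetOf_blendedTaylor hF hc hb
  have hcomp : IsCompact ((S ×ˢ stdCube k n) ×ˢ K) := (hS.prod (isCompact_stdCube k n)).prod hKc
  have hsub : (S ×ˢ stdCube k n) ×ˢ K ⊆ (S ×ˢ U) ×ˢ U :=
    prod_mono (prod_mono le_rfl hcube) hdU
  have hG1 := hcomp.uniformContinuousOn_of_continuous (hG.mono hsub)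
  have hFc : ContinuousOn (fun w : (EuclideanSpace ℝ (Fin m) × EuclideanSpace ℝ (Fin n)) ×
      EuclideanSpace ℝ (Fin n) => (F w.1.1 w.2).1) ((S ×ˢ stdCube k n) ×ˢ K) :=
    continuous_subtype_val.comp_continuousOn (hF.continuousOn.comp
      (f := fun w : (EuclideanSpace ℝ (Fin m) × EuclideanSpace ℝ (Fin n)) ×
        EuclideanSpace ℝ (Fin n) => (w.1.1, w.2)) (by fun_prop)
        fun w hw => ⟨⟨mem_univ _, hdU hw.2⟩, hw.1.1⟩)
  -- This difference vanishes for `x = p`, so by uniform continuity it is below `ε` for `x` near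
  -- `p`, uniformly in `z` and `p`.
  have hG2 := hcomp.uniformContinuousOn_of_continuous ((hG.mono hsub).sub hFc)
  obtain ⟨ν, hν, hνG⟩ := Metric.uniformContinuousOn_iff.1 hG2 ε hε
  obtain ⟨ρ₁, hρ₁, h₁⟩ := exists_forall_dist_lt n hν
  obtain ⟨ρ₂, hρ₂, h₂⟩ := exists_forall_dist_lt n hd
  -- The distance from `x` to the clipped `p` is estimated through the clipped `x`, hence `ρ₁ / 2`.
  obtain ⟨ρ, hρ, hρδ, hρκ, hρ1, hρ2⟩ : ∃ ρ > 0, ρ ≤ δ ∧ ρ ≤ κ ∧ ρ ≤ ρ₁ / 2 ∧ ρ ≤ ρ₂ :=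
    ⟨min (min δ κ) (min (ρ₁ / 2) ρ₂), by positivity, by simp, by simp, by simp, by simp⟩
  have htube : graphTube hkn ρ (fun _ => 0) ⊆ K := by
    intro x hx
    rw [mem_graphTube_zero] at hx
    exact Metric.mem_cthickening_of_dist_le x (cubeClip k n x) d _ (cubeClip_mem _)
      (h₂ _ _ fun i => (hx i).trans_le hρ2).le
  have hzero : ∀ z ∈ S, ∀ p ∈ stdCube k n,
      jetOf r (blendedTaylor F c b p z) p = (F z p).1 := fun z hz p hp =>
    jetOf_blendedTaylor_self ((hb z hz p (hcube hp)).contDiffAt hz) (hcb z hz p hp)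
  refine ⟨ρ, hρ, hρδ, htube, contDiff_const, fun y => by simpa using hδ, ?_, ?_, ?_, ?_⟩
  · intro p z hz x hx
    exact jetRegAt_blendedTaylor (ζ := id) le_rfl hF hc hb hz contDiffWithinAt_id
      contDiffWithinAt_const (mapsTo_id _) (fun _ _ => hcube (cubeClip_mem p)) (hdU (htube hx))
  · intro η hη
    obtain ⟨ν', hν', h⟩ := Metric.uniformContinuousOn_iff.1 hG1 η hη
    obtain ⟨ρ', hρ', h'⟩ := exists_forall_dist_lt n hν'
    refine ⟨ρ', hρ', fun p p' hp z hz x hx => ?_⟩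
    have := h ((z, cubeClip k n p), x) ⟨⟨hz, cubeClip_mem p⟩, htube hx⟩
      ((z, cubeClip k n p'), x) ⟨⟨hz, cubeClip_mem p'⟩, htube hx⟩ (by
        have := h' _ _ (abs_cubeClip_sub_le hρ' fun i (_ : (i : ℕ) < k) => hp i)
        simpa [Prod.dist_eq, hν'] using this)
    rw [dist_eq_norm] at this
    exact this.le
  · intro p z hz x hx hp
    have hdist : dist x (cubeClip k n p) < ν := by
      refine h₁ _ _ fun i => ?_
      have e1 := abs_lt.1 (mem_graphTube_zero.1 hx i)
      have e2 := abs_lt.1 (abs_cubeClip_sub_le hρ (fun i hi => hp i (Nat.zero_le _) hi) i)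
      rw [abs_lt]
      constructor <;> linarith
    have := hνG ((z, cubeClip k n p), x) ⟨⟨hz, cubeClip_mem p⟩, htube hx⟩
      ((z, cubeClip k n p), cubeClip k n p) ⟨⟨hz, cubeClip_mem p⟩, hcubeK (cubeClip_mem p)⟩ (by
        simpa [Prod.dist_eq, hν] using hdist)
    simp only [Pi.sub_apply, hzero z hz _ (cubeClip_mem p), sub_self, dist_zero_right] at this
    exact this
  · intro p z hz x hx hp
    have := hB z hz x hx p fun i hi => (hp i (Nat.zero_le _) hi).trans_le hρκ
    simp [blendedTaylor, this]

end Base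

/-! ### Gluing the prescribed holonomic germs -/

section Patch

variable {k m n q r : ℕ} {s : ℕ∞}

theorem jetRegAt_smul_of_tsupport {Z X E : Type} [NormedAddCommGroup Z] [NormedSpace ℝ Z]
    [NormedAddCommGroup X] [NormedSpace ℝ X] [NormedAddCommGroup E] [NormedSpace ℝ E] {S : Set Z}
    {f : Z → X → E} {z : Z} {x : X} {θ : X → ℝ} (hθ : ContDiff ℝ ∞ θ) (hz : z ∈ S)
    (h : x ∈ tsupport θ → JetRegAt s r S f z x) : JetRegAt s r S (fun z x => θ x • f z x) z x := by
  by_cases hx : x ∈ tsupport θ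
  · exact (jetRegAt_of_contDiff_const hθ).smul (h hx) hz
  · refine (jetRegAt_of_contDiff_const (h := fun _ => (0 : E)) contDiff_const).congr hz ?_
    have h0 := (continuous_snd.tendsto (z, x)).eventually (notMem_tsupport_iff_eventuallyEq.1 hx)
    filter_upwards [h0.filter_mono nhdsWithin_le_nhds] with w hw
    simp [hw]

theorem jetRegAt_smul_param_of_tsupport {Z X E : Type} [NormedAddCommGroup Z] [NormedSpace ℝ Z]
    [NormedAddCommGroup X] [NormedSpace ℝ X] [NormedAddCommGroup E] [NormedSpace ℝ E] {S : Set Z}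
    {f : Z → X → E} {z : Z} {x : X} {ψ : Z → ℝ} (hψ : ContDiff ℝ ∞ ψ) (hz : z ∈ S)
    (h : z ∈ tsupport ψ → JetRegAt s r S f z x) : JetRegAt s r S (fun z x => ψ z • f z x) z x := by
  by_cases hx : z ∈ tsupport ψ
  · exact (jetRegAt_of_contDiffWithinAt
      (hψ.of_le (by exact_mod_cast le_top)).contDiffWithinAt).smul (h hx) hz
  · refine (jetRegAt_of_contDiff_const (h := fun _ => (0 : E)) contDiff_const).congr hz ?_
    have h0 := (continuous_fst.tendsto (z, x)).eventually (notMem_tsupport_iff_eventuallyEq.1 hx)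
    filter_upwards [h0.filter_mono nhdsWithin_le_nhds] with w hw
    simp [hw]

/-- The maps may be chosen for each `z` separately: all their derivatives of order `0` to `r` are
components of `G`, so they inherit its joint regularity. -/
theorem exists_potential {P : Set (EuclideanSpace ℝ (Fin m))} {U : Set (EuclideanSpace ℝ (Fin n))}
    (hU : IsOpen U) {G : EuclideanSpace ℝ (Fin m) → EuclideanSpace ℝ (Fin n) → JetFiber r n q}
    (hG : IsSectionFamily s P (univ ×ˢ U) G) (hol : ∀ z ∈ P, IsHolonomicOn U (G z)) :
    ∃ g : EuclideanSpace ℝ (Fin m) → EuclideanSpace ℝ (Fin n) → EuclideanSpace ℝ (Fin q),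
      ∀ z ∈ P, ∀ x ∈ U, JetRegAt s r P g z x ∧ jetOf r (g z) x = (G z x).1 := by
  choose! g hg hjet using hol
  refine ⟨g, fun z hz x hx => ⟨⟨?_, fun j hj => ?_⟩, (hjet z hz x hx).symm⟩⟩
  · have h1 : ∀ᶠ w : EuclideanSpace ℝ (Fin m) × EuclideanSpace ℝ (Fin n) in
        𝓝[P ×ˢ univ] (z, x), w.2 ∈ U :=
      ((continuous_snd.tendsto (z, x)).eventually (hU.mem_nhds hx)).filter_mono nhdsWithin_le_nhds
    filter_upwards [h1, self_mem_nhdsWithin] with w hw hwP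
    exact (hg w.1 hwP.1).contDiffAt (hU.mem_nhds hw)
  · have hmem : {w : EuclideanSpace ℝ (Fin m) × EuclideanSpace ℝ (Fin n) |
        w ∈ univ ×ˢ U ∧ w.1 ∈ P} ∈ 𝓝[P ×ˢ univ] (z, x) := by
      have h1 : ∀ᶠ w : EuclideanSpace ℝ (Fin m) × EuclideanSpace ℝ (Fin n) in
          𝓝[P ×ˢ univ] (z, x), w.2 ∈ U :=
        ((continuous_snd.tendsto (z, x)).eventually (hU.mem_nhds hx)).filter_mono
          nhdsWithin_le_nhds
      filter_upwards [h1, self_mem_nhdsWithin] with w hw hwP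
      exact ⟨⟨mem_univ _, hw⟩, hwP.1⟩
    have h2 : ContDiffWithinAt ℝ s (fun w : EuclideanSpace ℝ (Fin m) × EuclideanSpace ℝ (Fin n) =>
        (G w.1 w.2).1) {w | w ∈ univ ×ˢ U ∧ w.1 ∈ P} (z, x) := by
      have h0 : ContDiffWithinAt ℝ s (fun w : EuclideanSpace ℝ (Fin m) × EuclideanSpace ℝ (Fin n) =>
        G w.1 w.2) {w | w ∈ univ ×ˢ U ∧ w.1 ∈ P} (z, x) := hG (z, x) ⟨⟨mem_univ _, hx⟩, hz⟩
      exact (JetFiber r n q).subtypeL.contDiff.comp_contDiffWithinAt h0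
    have h3 := contDiffWithinAt_pi.1 h2 ⟨j, Nat.lt_succ_of_le hj⟩
    refine ContDiffWithinAt.mono_of_mem_nhdsWithin (h3.congr (fun w hw => ?_) ?_) hmem
    · exact (congrFun (hjet w.1 hw.2 w.2 hw.1.2) ⟨j, Nat.lt_succ_of_le hj⟩).symm
    · exact (congrFun (hjet z hz x hx) ⟨j, Nat.lt_succ_of_le hj⟩).symm

/-- The given holonomic germs near `∂I^k` and near `∂I^m × I^k` fit together. -/
theorem exists_boundary_patch {S : Set (EuclideanSpace ℝ (Fin m))}
    {U : Set (EuclideanSpace ℝ (Fin n))} (hU : IsOpen U) (hIU : stdCube k n ⊆ U)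
    (F : EuclideanSpace ℝ (Fin m) → EuclideanSpace ℝ (Fin n) → JetFiber r n q)
    (hbdry : ∃ V : Set (EuclideanSpace ℝ (Fin n)), IsOpen V ∧ stdCubeBdry k n ⊆ V ∧
      IsHolonomicFamilyOver s S V F)
    (hparam : ∃ W : Set (EuclideanSpace ℝ (Fin m)), IsOpen W ∧ stdCubeBdry m m ⊆ W ∧
      IsHolonomicFamilyOver s (W ∩ S) (stdCube k n) F) :
    ∃ (W : Set (EuclideanSpace ℝ (Fin m))) (V O : Set (EuclideanSpace ℝ (Fin n)))
      (b : EuclideanSpace ℝ (Fin m) → EuclideanSpace ℝ (Fin n) → EuclideanSpace ℝ (Fin q)),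
      IsOpen W ∧ stdCubeBdry m m ⊆ W ∧ IsOpen V ∧ stdCubeBdry k n ⊆ V ∧ IsOpen O ∧
      stdCube k n ⊆ O ∧ O ⊆ U ∧ (∀ z ∈ S, ∀ x ∈ O, JetRegAt s r S b z x) ∧
      (∀ z ∈ S, ∀ x ∈ V, jetOf r (b z) x = (F z x).1) ∧
      (∀ z ∈ S, z ∈ W → ∀ x ∈ stdCube k n, jetOf r (b z) x = (F z x).1) ∧
      ((∃ (W : Set (EuclideanSpace ℝ (Fin m))) (V : Set (EuclideanSpace ℝ (Fin n))),
          IsOpen W ∧ stdCubeBdry m m ⊆ W ∧ IsOpen V ∧ stdCube k n ⊆ V ∧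
          IsHolonomicFamilyOver s (W ∩ S) V F) →
        ∀ z ∈ S, z ∈ W → ∀ x ∈ O, jetOf r (b z) x = (F z x).1) := by
  obtain ⟨V₀, hV₀, hbV₀, U₀, hU₀, hVU₀, G₀, hG₀, hG₀'⟩ := hbdry
  obtain ⟨f, hf⟩ := exists_potential hU₀ hG₀ fun z hz => (hG₀' z hz).1
  obtain ⟨W₀, O₀, A, g, hW₀, hbW₀, hO₀, hcO₀, hcA, hg, hgF, hgA⟩ :
      ∃ (W₀ : Set (EuclideanSpace ℝ (Fin m))) (O₀ A : Set (EuclideanSpace ℝ (Fin n)))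
        (g : EuclideanSpace ℝ (Fin m) → EuclideanSpace ℝ (Fin n) → EuclideanSpace ℝ (Fin q)),
        IsOpen W₀ ∧ stdCubeBdry m m ⊆ W₀ ∧ IsOpen O₀ ∧ stdCube k n ⊆ O₀ ∧ stdCube k n ⊆ A ∧
        (∀ z ∈ W₀ ∩ S, ∀ x ∈ O₀, JetRegAt s r (W₀ ∩ S) g z x) ∧
        (∀ z ∈ W₀ ∩ S, ∀ x ∈ O₀ ∩ A, jetOf r (g z) x = (F z x).1) ∧
        ((∃ (W : Set (EuclideanSpace ℝ (Fin m))) (V : Set (EuclideanSpace ℝ (Fin n))),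
          IsOpen W ∧ stdCubeBdry m m ⊆ W ∧ IsOpen V ∧ stdCube k n ⊆ V ∧
          IsHolonomicFamilyOver s (W ∩ S) V F) → O₀ ⊆ A) := by
    -- The patch must serve both versions of the conclusion near `∂I^m`. If the stronger hypothesis
    -- holds, its germ is used and `A` is open; otherwise the jets agree with `F` only on the cube.
    by_cases hyp : ∃ (W : Set (EuclideanSpace ℝ (Fin m))) (V : Set (EuclideanSpace ℝ (Fin n))),
      IsOpen W ∧ stdCubeBdry m m ⊆ W ∧ IsOpen V ∧ stdCube k n ⊆ V ∧
      IsHolonomicFamilyOver s (W ∩ S) V F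
    · obtain ⟨W, V, hW, hbW, hV, hcV, U₁, hU₁, hVU₁, G, hG, hG'⟩ := hyp
      obtain ⟨g, hg⟩ := exists_potential hU₁ hG fun z hz => (hG' z hz).1
      refine ⟨W, V, V, g, hW, hbW, hV, hcV, hcV, fun z hz x hx => (hg z hz x (hVU₁ hx)).1, ?_,
        fun _ => le_rfl⟩
      intro z hz x hx
      rw [(hg z hz x (hVU₁ hx.1)).2, (hG' z hz).2 hx.1]
    · obtain ⟨W, hW, hbW, U₁, hU₁, hVU₁, G, hG, hG'⟩ := hparam
      obtain ⟨g, hg⟩ := exists_potential hU₁ hG fun z hz => (hG' z hz).1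
      refine ⟨W, U₁, stdCube k n, g, hW, hbW, hU₁, hVU₁, le_rfl,
        fun z hz x hx => (hg z hz x hx).1, ?_, fun h => absurd h hyp⟩
      intro z hz x hx
      rw [(hg z hz x hx.1).2, (hG' z hz).2 hx.2]
  obtain ⟨χ, hχ, -, hχV, V, hV, hbV, hVV₀, hχ1⟩ :=
    exists_contDiff_bump (isClosed_stdCubeBdry k n) hV₀ hbV₀
  obtain ⟨ψ, hψ, -, hψW, W, hW, hbW, hWW₀, hψ1⟩ :=
    exists_contDiff_bump (isClosed_stdCubeBdry m m) hW₀ hbW₀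
  have hjetW : ∀ z ∈ S, z ∈ W → ∀ x ∈ O₀ ∩ A,
      jetOf r (fun x => χ x • f z x + (1 - χ x) • ψ z • g z x) x = (F z x).1 := by
    intro z hz hzW x hx
    have hgx := hg z ⟨hWW₀ hzW, hz⟩ x hx.1
    have hgc : ContDiffAt ℝ r (g z) x := hgx.contDiffAt ⟨hWW₀ hzW, hz⟩
    -- For `z ∈ W` the weight `ψ z` is one, so the patch is `g + χ • (f - g)`. On the support of `χ`
    -- both `f` and `g` have jet `F`, so the correction has jet zero.
    have e1 : (fun x => χ x • f z x + (1 - χ x) • ψ z • g z x) =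
        fun x => g z x + χ x • (f z x - g z x) := by
      funext y
      rw [hψ1 z hzW, one_smul, sub_smul, one_smul, smul_sub]
      abel
    have hgF' := hgF z ⟨hWW₀ hzW, hz⟩ x hx
    rw [e1]
    by_cases hxs : x ∈ tsupport χ
    · have hxV₀ := hχV hxs
      have hfx := hf z hz x (hVU₀ hxV₀)
      have hfc : ContDiffAt ℝ r (f z) x := hfx.1.contDiffAt hz
      have e2 : jetOf r (fun y => f z y - g z y) x = 0 := by
        rw [jetOf_sub hfc hgc, hfx.2, (hG₀' z hz).2 hxV₀, hgF', sub_self]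
      have hχc : ContDiffAt ℝ r χ x := hχ.contDiffAt.of_le (by exact_mod_cast le_top)
      have e3 : ContDiffAt ℝ r (fun y => χ y • (f z y - g z y)) x := hχc.smul (hfc.sub hgc)
      rw [jetOf_add hgc e3, jetOf_smul_eq_zero hχ (hfc.sub hgc) e2, add_zero, hgF']
    · rw [← hgF']
      refine jetOf_congr ?_
      filter_upwards [notMem_tsupport_iff_eventuallyEq.1 hxs] with y hy
      simp [hy]
  refine ⟨W, V, O₀ ∩ U, fun z x => χ x • f z x + (1 - χ x) • ψ z • g z x, hW, hbW, hV, hbV,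
    hO₀.inter hU, subset_inter hcO₀ hIU, inter_subset_right, ?_, ?_,
    fun z hz hzW x hx => hjetW z hz hzW x ⟨hcO₀ hx, hcA hx⟩,
    fun hyp z hz hzW x hx => hjetW z hz hzW x ⟨hx.1, hgA hyp hx.1⟩⟩
  · intro z hz x hx
    have h1 := jetRegAt_smul_of_tsupport (s := s) (r := r) (S := S) (f := f) (z := z) (x := x) hχ hz
      fun hxs => (hf z hz x (hVU₀ (hχV hxs))).1
    have h2 := jetRegAt_smul_param_of_tsupport (s := s) (r := r) (S := S) (f := g) (z := z) (x := x)
      hψ hz fun hzs => (hg z ⟨hψW hzs, hz⟩ x hx.1).mono_set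
        (inter_mem (mem_nhdsWithin_of_mem_nhds (hW₀.mem_nhds (hψW hzs))) self_mem_nhdsWithin)
    exact h1.add ((jetRegAt_of_contDiff_const (contDiff_const.sub hχ)).smul h2 hz) hz
  · intro z hz x hx
    have h1 : (fun x => χ x • f z x + (1 - χ x) • ψ z • g z x) =ᶠ[𝓝 x] f z := by
      filter_upwards [hV.mem_nhds hx] with y hy
      simp [hχ1 y hy]
    rw [jetOf_congr h1, (hf z hz x (hVU₀ (hVV₀ hx))).2, (hG₀' z hz).2 (hVV₀ hx)]

end Patch

/-! ### Vertical shears as diffeomorphisms -/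

section Shear

variable {k n : ℕ} {hkn : k < n} {φ : EuclideanSpace ℝ (Fin k) → ℝ}

theorem firstCoords_verticalShear (x : EuclideanSpace ℝ (Fin n)) :
    firstCoords hkn (verticalShear hkn φ x) = firstCoords hkn x := by
  ext i
  have : (i : ℕ) + 1 ≠ n := by omega
  simp [firstCoords, verticalShear, this]

theorem cubeClip_verticalShear (x : EuclideanSpace ℝ (Fin n)) :
    cubeClip k n (verticalShear hkn φ x) = cubeClip k n x := by
  ext i
  by_cases hi : (i : ℕ) < k
  · have : (i : ℕ) + 1 ≠ n := by omega
    simp [cubeClip, verticalShear, this]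
  · simp [cubeClip, hi]

theorem contDiff_verticalShear (hφ : ContDiff ℝ ∞ φ) : ContDiff ℝ ∞ (verticalShear hkn φ) := by
  unfold verticalShear
  refine (contDiff_piLp (p := 2)).2 fun i => ?_
  have h2 : ContDiff ℝ ∞ fun x : EuclideanSpace ℝ (Fin n) => x i := by fun_prop
  by_cases hi : (i : ℕ) + 1 = n
  · simpa [hi] using h2.add (hφ.comp (contDiff_firstCoords (hkn := hkn)))
  · simpa [hi] using h2

theorem verticalShear_neg (ψ : EuclideanSpace ℝ (Fin k) → ℝ) (h : ∀ y, ψ y + φ y = 0)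
    (x : EuclideanSpace ℝ (Fin n)) : verticalShear hkn φ (verticalShear hkn ψ x) = x := by
  ext i
  have e : verticalShear hkn φ (verticalShear hkn ψ x) i =
      if (i : ℕ) + 1 = n then
        verticalShear hkn ψ x i + φ (firstCoords hkn (verticalShear hkn ψ x))
      else verticalShear hkn ψ x i := rfl
  rw [e, firstCoords_verticalShear]
  by_cases hi : (i : ℕ) + 1 = n
  · simp [verticalShear, hi, add_assoc, h]
  · simp [verticalShear, hi]

/-- The vertical shear along a smooth function, as a diffeomorphism. -/
noncomputable def shearDiffeomorph (hkn : k < n) (φ : EuclideanSpace ℝ (Fin k) → ℝ)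
    (hφ : ContDiff ℝ ∞ φ) : EuclideanSpace ℝ (Fin n) ≃ₘ[ℝ] EuclideanSpace ℝ (Fin n) where
  toFun := verticalShear hkn φ
  invFun := verticalShear hkn fun y => -φ y
  left_inv := verticalShear_neg _ fun y => by simp
  right_inv := verticalShear_neg _ fun y => by simp
  contMDiff_toFun := (contDiff_verticalShear hφ).contMDiff
  contMDiff_invFun := (contDiff_verticalShear hφ.neg).contMDiff

/-- The inclusion of `ℝ^k` as the subspace of the first `k` coordinates of `ℝⁿ`. -/
noncomputable def coordEmbed (k n : ℕ) (y : EuclideanSpace ℝ (Fin k)) : EuclideanSpace ℝ (Fin n) :=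
  WithLp.toLp 2 fun i => if h : (i : ℕ) < k then y ⟨i, h⟩ else 0

theorem contDiff_coordEmbed : ContDiff ℝ ∞ (coordEmbed k n) := by
  unfold coordEmbed
  refine (contDiff_piLp (p := 2)).2 fun i => ?_
  by_cases hi : (i : ℕ) < k
  · simp only [hi, dite_true]
    fun_prop
  · simp only [hi, dite_false]
    exact contDiff_const

theorem coordEmbed_firstCoords {x : EuclideanSpace ℝ (Fin n)} (hx : x ∈ stdCube k n) :
    coordEmbed k n (firstCoords hkn x) = x := by
  ext i
  have := hx i
  by_cases hi : (i : ℕ) < k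
  · simp [coordEmbed, firstCoords, hi]
  · simp [hi] at this
    simp [coordEmbed, hi, this]

theorem coordEmbed_mem_stdCubeBdry (hkn : k < n) {y : EuclideanSpace ℝ (Fin k)}
    (hy : y ∈ stdCubeBdry k k) : coordEmbed k n y ∈ stdCubeBdry k n := by
  obtain ⟨hy, j, hj, hyj⟩ := hy
  refine ⟨fun i => ?_, ⟨j, by omega⟩, hj, ?_⟩
  · split_ifs with hi
    · have := hy ⟨i, hi⟩
      simp only [hi, if_true] at this
      simpa [coordEmbed, hi] using this
    · simp [coordEmbed, hi]
  · simpa [coordEmbed] using hyj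

end Shear

/-! ### Assembly of the holonomic approximation -/

theorem theorem1p3p3 (k m n q r : ℕ) (hkn : k < n) (s : ℕ∞)
    -- a family `F_z`, `z ∈ I^m`, of sections of `J^r(ℝⁿ, ℝ^q)` over a neighbourhood `U` of `I^k`
    (U : Set (EuclideanSpace ℝ (Fin n))) (hU : IsOpen U) (hIU : stdCube k n ⊆ U)
    (F : EuclideanSpace ℝ (Fin m) → EuclideanSpace ℝ (Fin n) → JetFiber r n q)
    (hF : IsSectionFamily s (stdCube m m) (Set.univ ×ˢ U) F)
    -- `F_z` is holonomic over a neighbourhood of `∂I^k` for all `z ∈ I^m`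
    (hbdry : ∃ V : Set (EuclideanSpace ℝ (Fin n)), IsOpen V ∧ stdCubeBdry k n ⊆ V ∧
      IsHolonomicFamilyOver s (stdCube m m) V F)
    -- `F_z` is holonomic over `I^k` for `z` in a neighbourhood of `∂I^m`
    (hparam : ∃ W : Set (EuclideanSpace ℝ (Fin m)), IsOpen W ∧ stdCubeBdry m m ⊆ W ∧
      IsHolonomicFamilyOver s (W ∩ stdCube m m) (stdCube k n) F)
    (δ ε : ℝ) (hδ : 0 < δ) (hε : 0 < ε) :
    ∃ (φ : EuclideanSpace ℝ (Fin m) → EuclideanSpace ℝ (Fin k) → ℝ)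
      (h : EuclideanSpace ℝ (Fin m) → EuclideanSpace ℝ (Fin n) ≃ₘ[ℝ] EuclideanSpace ℝ (Fin n))
      (Ω : Set (EuclideanSpace ℝ (Fin m) × EuclideanSpace ℝ (Fin n)))
      (Ft : EuclideanSpace ℝ (Fin m) → EuclideanSpace ℝ (Fin n) → JetFiber r n q),
      -- a smooth family of diffeomorphisms of the required form
      ContDiffOn ℝ ∞ (Function.uncurry φ) (stdCube m m ×ˢ Set.univ) ∧
      (∀ z ∈ stdCube m m, ∀ x, h z x = verticalShear hkn (φ z) x) ∧
      -- a family of holonomic sections `Ft_z` over neighbourhoods `{x | (z, x) ∈ Ω}` of `h_z(I^k)`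
      IsOpen Ω ∧
      (∀ z ∈ stdCube m m, ∀ x ∈ stdCube k n, (z, h z x) ∈ Ω) ∧
      IsSectionFamily s (stdCube m m) Ω Ft ∧
      (∀ z ∈ stdCube m m, IsHolonomicOn {x | (z, x) ∈ Ω} (Ft z)) ∧
      -- `|φ_z| < δ`, and `φ_z = 0` near `∂I^k`
      (∀ z ∈ stdCube m m, ∀ y, |φ z y| < δ) ∧
      (∃ V : Set (EuclideanSpace ℝ (Fin k)), IsOpen V ∧ stdCubeBdry k k ⊆ V ∧
        ∀ z ∈ stdCube m m, ∀ y ∈ V, φ z y = 0) ∧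
      -- `F_z` is defined in a neighbourhood of `h_z(I^k)`
      (∀ z ∈ stdCube m m, ∀ x, (z, x) ∈ Ω → x ∈ U) ∧
      -- `Ft_z = F_z` near `∂I^k`
      (∃ V : Set (EuclideanSpace ℝ (Fin n)), IsOpen V ∧ stdCubeBdry k n ⊆ V ∧
        ∀ z ∈ stdCube m m, ∀ x ∈ V, (z, x) ∈ Ω ∧ Ft z x = F z x) ∧
      -- `Ft_z = F_z` over `h_z(I^k)` for `z` near `∂I^m`
      (∃ W : Set (EuclideanSpace ℝ (Fin m)), IsOpen W ∧ stdCubeBdry m m ⊆ W ∧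
        ∀ z ∈ W ∩ stdCube m m, ∀ x ∈ stdCube k n, Ft z (h z x) = F z (h z x)) ∧
      -- even on a whole neighbourhood of `h_z(I^k)`, if `F_z` is holonomic on a neighbourhood
      -- of `I^k` for `z` near `∂I^m`
      ((∃ (W : Set (EuclideanSpace ℝ (Fin m))) (V : Set (EuclideanSpace ℝ (Fin n))),
          IsOpen W ∧ stdCubeBdry m m ⊆ W ∧ IsOpen V ∧ stdCube k n ⊆ V ∧
          IsHolonomicFamilyOver s (W ∩ stdCube m m) V F) →
        ∃ W : Set (EuclideanSpace ℝ (Fin m)), IsOpen W ∧ stdCubeBdry m m ⊆ W ∧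
          ∀ z ∈ W ∩ stdCube m m, ∀ x, (z, x) ∈ Ω → Ft z x = F z x) ∧
      -- `Ft_z` is `ε`-close to `F_z`
      (∀ z ∈ stdCube m m, ∀ x, (z, x) ∈ Ω → ‖Ft z x - F z x‖ < ε) := by
  set S := stdCube m m with hSdef
  obtain ⟨W, V, O, b, hW, hbW, hV, hbV, hO, hcO, hOU, hbreg, hbV', hbW', hbO⟩ :=
    exists_boundary_patch (r := r) hU hIU F hbdry hparam
  obtain ⟨c₁, hc₁, -, hc₁W, W₁, hW₁, hbW₁, hW₁W, hc₁1⟩ :=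
    exists_contDiff_bump (isClosed_stdCubeBdry m m) hW hbW
  obtain ⟨d₁, hd₁, hd₁I, hd₁W, W₂, hW₂, hbW₂, hW₂W, hd₁1⟩ :=
    exists_contDiff_bump (isClosed_stdCubeBdry m m) hW₁ hbW₁
  obtain ⟨c₂, hc₂, -, hc₂V, V₁, hV₁, hbV₁, hV₁V, hc₂1⟩ :=
    exists_contDiff_bump (isClosed_stdCubeBdry k n) hV hbV
  obtain ⟨d, hd, hdV₁⟩ := ((isCompact_stdCube k n).of_isClosed_subset (isClosed_stdCubeBdry k n)
    stdCubeBdry_subset).exists_thickening_subset_open hV₁ hbV₁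
  -- Half of the thickening leaves room: if the clipped `x` lies in `V₂`, then the clipped `p` lies
  -- in `V₁` for every `p` within `κ` of `x`.
  set V₂ := Metric.thickening (d / 2) (stdCubeBdry k n) with hV₂def
  have hV₂ : IsOpen V₂ := Metric.isOpen_thickening
  have hbV₂ : stdCubeBdry k n ⊆ V₂ := Metric.self_subset_thickening (by linarith) _
  obtain ⟨d₂, hd₂, hd₂I, hd₂V, V₃, hV₃, hbV₃, hV₃V, hd₂1⟩ :=
    exists_contDiff_bump (isClosed_stdCubeBdry k n) hV₂ hbV₂
  obtain ⟨κ, hκ, hκd⟩ := exists_forall_dist_lt n (half_pos hd)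
  -- Equal to one as soon as one of the two cutoffs is one, and zero where both vanish.
  let c : EuclideanSpace ℝ (Fin m) → EuclideanSpace ℝ (Fin n) → ℝ := fun z x =>
    1 - (1 - c₁ z) * (1 - c₂ x)
  have hc : ContDiff ℝ ∞ (Function.uncurry c) := contDiff_const.sub
    ((contDiff_const.sub (hc₁.comp contDiff_fst)).mul
      (contDiff_const.sub (hc₂.comp contDiff_snd)))
  let B : EuclideanSpace ℝ (Fin m) → EuclideanSpace ℝ (Fin n) → Prop := fun z x =>
    z ∈ W₁ ∨ cubeClip k n x ∈ V₂
  have hclip : Continuous fun x : EuclideanSpace ℝ (Fin n) => cubeClip k n x :=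
    continuous_cubeClip.comp (PiLp.continuous_ofLp 2 _)
  have hBopen : IsOpen {w : EuclideanSpace ℝ (Fin m) × EuclideanSpace ℝ (Fin n) | B w.1 w.2} :=
    (hW₁.preimage continuous_fst).union (hV₂.preimage (hclip.comp continuous_snd))
  have hcb : ∀ z ∈ S, ∀ x ∈ stdCube k n, c z x ≠ 0 → jetOf r (b z) x = (F z x).1 := by
    intro z hz x hx hcz
    by_cases h1 : c₁ z = 0
    · have h2 : c₂ x ≠ 0 := fun h2 => hcz (by simp [c, h1, h2])
      exact hbV' z hz x (hc₂V (subset_tsupport _ h2))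
    · exact hbW' z hz (hc₁W (subset_tsupport _ h1)) x hx
  have hcB : ∀ z ∈ S, ∀ x, B z x → ∀ p : Fin n → ℝ,
      (∀ i : Fin n, (i : ℕ) < k → |p i - x i| < κ) → c z (cubeClip k n p) = 1 := by
    intro z hz x hB p hp
    rcases hB with h | h
    · simp [c, hc₁1 z h]
    · obtain ⟨y, hy, hxy⟩ := Metric.mem_thickening_iff.1 h
      have h1 : dist (cubeClip k n p) (cubeClip k n x) < d / 2 :=
        hκd _ _ (abs_cubeClip_sub_le hκ hp)
      have h2 : cubeClip k n p ∈ V₁ := hdV₁ (Metric.mem_thickening_iff.2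
        ⟨y, hy, by linarith [dist_triangle (cubeClip k n p) (cubeClip k n x) y]⟩)
      simp [c, hc₂1 _ h2]
  have hF' : IsSectionFamily s S (univ ×ˢ O) F :=
    hF.mono fun w hw => ⟨⟨mem_univ _, hOU hw.1.2⟩, hw.2⟩
  obtain ⟨K, hKO, hK, hbase⟩ := exists_fiberApprox_zero hkn (isCompact_stdCube m m) hO hcO hF' hc
    hbreg hcb hκ hcB
  -- The base is used twice. The first size `ρ₀` gives a box on which the initial maps, and so `b`
  -- on `B`, are `ε`-close to `F`. The second starts the induction with heights and error small
  -- enough for the final graph and its tube to stay in this box.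
  obtain ⟨ρ₀, hρ₀, -, h₀⟩ := hbase 1 one_pos ε hε
  obtain ⟨ρ₁, hρ₁, hρ₁', h₁⟩ := hbase (min (δ / 2) (ρ₀ / 4)) (by positivity) (ε / 2) (by linarith)
  obtain ⟨ρ, φ, f, hρ, hρρ₁, happ⟩ := h₁.exists_full hK hρ₁ k le_rfl (min δ (ρ₀ / 2))
    (lt_min ((min_le_left _ _).trans_lt (by linarith)) ((min_le_right _ _).trans_lt (by linarith)))
    ε (by linarith)
  have hφδ : ∀ y, |φ y| < δ := fun y => (happ.small y).trans_le (min_le_left _ _)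
  have hφρ : ∀ y, |φ y| < ρ₀ / 2 := fun y => (happ.small y).trans_le (min_le_right _ _)
  set box := graphTube hkn ρ₀ (fun _ => 0) with hbox
  have htube : graphTube hkn ρ φ ⊆ box := graphTube_subset fun y => by
    have h1 := hφρ y
    have h2 : ρ ≤ ρ₀ / 4 := hρρ₁.trans (hρ₁'.trans (min_le_right _ _))
    rw [sub_zero]
    linarith
  have hboxO : box ⊆ O := h₀.subset.trans hKO
  have hboxopen : IsOpen box := isOpen_graphTube continuous_const
  have hcubebox : stdCube k n ⊆ box := fun x hx => mem_graphTube_zero.2 fun i => by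
    rw [cubeClip_of_mem hx, sub_self, abs_zero]
    exact hρ₀
  -- After `k` steps no coordinate of `p` is constrained, so any value of `p` would do.
  let ft : EuclideanSpace ℝ (Fin m) → EuclideanSpace ℝ (Fin n) → EuclideanSpace ℝ (Fin q) := f 0
  have hft : ∀ z ∈ S, ∀ x, B z x → ft z x = b z x := fun z hz x hB =>
    happ.bdry 0 z hz x hB fun i h1 h2 => absurd h1 (by omega)
  -- On `B` the map is `b` at every height, so there the whole box is allowed and not only the tube.
  -- This accommodates the cut-off graph.
  let Ω : Set (EuclideanSpace ℝ (Fin m) × EuclideanSpace ℝ (Fin n)) :=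
    {w | w.2 ∈ graphTube hkn ρ φ ∨ (B w.1 w.2 ∧ w.2 ∈ box)}
  have hΩbox : ∀ z x, (z, x) ∈ Ω → x ∈ box := by
    rintro z x (h | h)
    · exact htube h
    · exact h.2
  have hΩopen : IsOpen Ω := ((isOpen_graphTube happ.smooth.continuous).preimage
    continuous_snd).union (hBopen.inter (hboxopen.preimage continuous_snd))
  have hBjet : ∀ z ∈ S, ∀ x, B z x → jetOf r (ft z) x = jetOf r (b z) x := by
    intro z hz x hB
    refine jetOf_congr ?_
    have h1 : Continuous fun y : EuclideanSpace ℝ (Fin n) => (z, y) := by fun_prop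
    filter_upwards [(h1.tendsto x).eventually (hBopen.mem_nhds hB)] with y hy using hft z hz y hy
  have hreg : ∀ z ∈ S, ∀ x, (z, x) ∈ Ω → JetRegAt s r S ft z x := by
    rintro z hz x (h | h)
    · exact happ.reg 0 z hz x h
    · refine (hbreg z hz x (hboxO h.2)).congr hz ?_
      filter_upwards [mem_nhdsWithin_of_mem_nhds (hBopen.mem_nhds h.1), self_mem_nhdsWithin]
        with w hw hwS using (hft w.1 hwS.1 w.2 hw).symm
  obtain ⟨π, hπ⟩ := exists_proj_jetFiber r n q
  have hFt : ∀ z ∈ S, ∀ x, (z, x) ∈ Ω → (π (jetOf r (ft z) x)).1 = jetOf r (ft z) x :=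
    fun z hz x hx => congrArg Subtype.val
      (hπ ⟨_, jetOf_mem_jetFiber ((hreg z hz x hx).contDiffAt hz)⟩)
  let Φ : EuclideanSpace ℝ (Fin m) → EuclideanSpace ℝ (Fin k) → ℝ := fun z y =>
    (1 - d₁ z) * (1 - d₂ (coordEmbed k n y)) * φ y
  have hΦ : ContDiff ℝ ∞ (Function.uncurry Φ) :=
    ((contDiff_const.sub (hd₁.comp contDiff_fst)).mul (contDiff_const.sub
      (hd₂.comp (contDiff_coordEmbed.comp contDiff_snd)))).mul (happ.smooth.comp contDiff_snd)
  have hΦz : ∀ z, ContDiff ℝ ∞ (Φ z) := fun z => hΦ.comp (contDiff_const.prodMk contDiff_id)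
  have hΦle : ∀ z y, |Φ z y| ≤ |φ y| := by
    intro z y
    have h1 := hd₁I z
    have h2 := hd₂I (coordEmbed k n y)
    simp only [Φ]
    rw [abs_mul]
    refine mul_le_of_le_one_left (abs_nonneg _) ?_
    rw [abs_of_nonneg (mul_nonneg (by linarith [h1.2]) (by linarith [h2.2]))]
    exact mul_le_one₀ (by linarith [h1.1]) (by linarith [h2.2]) (by linarith [h2.1])
  have hΦ0 : ∀ z ∈ W₂, ∀ y, Φ z y = 0 := fun z hz y => by simp [Φ, hd₁1 z hz]
  have hBF : ∀ z ∈ S, ∀ x, (z, x) ∈ Ω → B z x → jetOf r (b z) x = (F z x).1 →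
      π (jetOf r (ft z) x) = F z x := fun z hz x hx hB h =>
    Subtype.ext (by rw [hFt z hz x hx, hBjet z hz x hB, h])
  have hmemB : ∀ z, ∀ x ∈ stdCube k n, B z x → (z, x) ∈ Ω := fun z x hx hB =>
    Or.inr ⟨hB, hcubebox hx⟩
  refine ⟨Φ, fun z => shearDiffeomorph hkn (Φ z) (hΦz z), Ω, fun z x => π (jetOf r (ft z) x),
    hΦ.contDiffOn, fun z hz x => rfl, hΩopen, ?_, ?_, ?_, ?_, ?_, ?_, ?_, ?_, ?_, ?_⟩
  · intro z hz x hx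
    change (z, verticalShear hkn (Φ z) x) ∈ Ω
    -- Where both cutoffs vanish the shear follows `φ` and lands in the tube. Elsewhere `B` holds
    -- and landing in the box suffices.
    by_cases h : d₁ z = 0 ∧ d₂ x = 0
    · refine Or.inl fun i => ?_
      simp only [firstCoords_verticalShear]
      rw [cubeClip_verticalShear, cubeClip_of_mem hx]
      have e : Φ z (firstCoords hkn x) = φ (firstCoords hkn x) := by
        simp [Φ, coordEmbed_firstCoords hx, h.1, h.2]
      by_cases hi : (i : ℕ) + 1 = n
      · simpa [verticalShear, hi, e] using hρ
      · simpa [verticalShear, hi] using hρ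
    · refine Or.inr ⟨?_, mem_graphTube_zero.2 fun i => ?_⟩
      · by_cases h1 : d₁ z = 0
        · have h2 : d₂ x ≠ 0 := fun h2 => h ⟨h1, h2⟩
          right
          change cubeClip k n (verticalShear hkn (Φ z) x) ∈ V₂
          rw [cubeClip_verticalShear, cubeClip_of_mem hx]
          exact hd₂V (subset_tsupport _ h2)
        · exact Or.inl (hd₁W (subset_tsupport _ h1))
      · change |verticalShear hkn (Φ z) x i - cubeClip k n (verticalShear hkn (Φ z) x) i| < ρ₀
        rw [cubeClip_verticalShear, cubeClip_of_mem hx]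
        have h3 := (hΦle z (firstCoords hkn x)).trans_lt (hφρ _)
        by_cases hi : (i : ℕ) + 1 = n
        · simp only [verticalShear, hi, if_true, add_sub_cancel_left]
          linarith
        · simpa [verticalShear, hi] using hρ₀
  · intro w hw
    have h1 : ContDiffWithinAt ℝ s (fun w : EuclideanSpace ℝ (Fin m) × EuclideanSpace ℝ (Fin n) =>
        jetOf r (ft w.1) w.2) {p | p ∈ Ω ∧ p.1 ∈ S} w := by
      refine contDiffWithinAt_pi.2 fun j => ?_
      exact ((hreg w.1 hw.2 w.2 hw.1).2 j (Nat.le_of_lt_succ j.2)).mono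
        fun p hp => ⟨hp.2, mem_univ _⟩
    have hπc : ContDiff ℝ s π := by fun_prop
    exact hπc.comp_contDiffWithinAt h1
  · intro z hz
    exact ⟨ft z, fun x hx => ((hreg z hz x hx).contDiffAt hz).contDiffWithinAt,
      fun x hx => hFt z hz x hx⟩
  · exact fun z hz y => (hΦle z y).trans_lt (hφδ y)
  · refine ⟨coordEmbed k n ⁻¹' V₃, hV₃.preimage contDiff_coordEmbed.continuous,
      fun y hy => hbV₃ (coordEmbed_mem_stdCubeBdry hkn hy), fun z hz y hy => ?_⟩
    simp [Φ, hd₂1 _ hy]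
  · exact fun z hz x hx => hOU (hboxO (hΩbox z x hx))
  · refine ⟨((fun x : EuclideanSpace ℝ (Fin n) => cubeClip k n x) ⁻¹' V₂ ∩ box) ∩ V,
      ((hV₂.preimage hclip).inter hboxopen).inter hV, ?_, ?_⟩
    · intro x hx
      refine ⟨⟨?_, hcubebox hx.1⟩, hbV hx⟩
      change cubeClip k n x ∈ V₂
      rw [cubeClip_of_mem hx.1]
      exact hbV₂ hx
    · intro z hz x hx
      have hB : B z x := Or.inr hx.1.1
      exact ⟨Or.inr ⟨hB, hx.1.2⟩, hBF z hz x (Or.inr ⟨hB, hx.1.2⟩) hB (hbV' z hz x hx.2)⟩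
  · refine ⟨W₂, hW₂, hbW₂, fun z hz x hx => ?_⟩
    have e : shearDiffeomorph hkn (Φ z) (hΦz z) x = x := by
      change verticalShear hkn (Φ z) x = x
      ext i
      simp [verticalShear, hΦ0 z hz.1]
    have hB : B z x := Or.inl (hW₂W hz.1)
    rw [e]
    exact hBF z hz.2 x (hmemB z x hx hB) hB (hbW' z hz.2 (hW₁W (hW₂W hz.1)) x hx)
  · intro hyp
    refine ⟨W₂, hW₂, hbW₂, fun z hz x hx => ?_⟩
    have hB : B z x := Or.inl (hW₂W hz.1)
    exact hBF z hz.2 x hx hB (hbO hyp z hz.2 (hW₁W (hW₂W hz.1)) x (hboxO (hΩbox z x hx)))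
  · intro z hz x hx
    change ‖(π (jetOf r (ft z) x)).1 - (F z x).1‖ < ε
    rw [hFt z hz x hx]
    rcases hx with h | h
    · exact happ.close 0 z hz x h fun i h1 h2 => absurd h1 (by omega)
    -- On `B` the initial map based at the clipped `x` is `b z` itself, so the first use of the base
    -- gives the estimate.
    · have e : blendedTaylor F c b (cubeClip k n x) z = b z := by
        funext y
        simp [blendedTaylor, hcB z hz x h.1 x fun i _ => by simpa using hκ]
      have := h₀.close x z hz x h.2 fun i _ _ => by simpa using hρ₀
      simp only [e] at this
      rwa [hBjet z hz x h.1]
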